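/- Let $K,M,n,m,s$ be natural numbers with $s\le m$, and let $S_1,\dots,S_K\subset\mathbb R^M$ be deterministic $m$-dimensional subspaces. Suppose $S_k$ has an orthonormal basis matrix $U_k=[U,\hat U_k]$, where $U$ has $s$ columns and is common to all $k$, and $\hat U_k$ has $m-s$ columns. Assume that $S_k\not\subseteq\sum_{i\ne k}S_i$ for every $k$ (Innovation Assumption). The data (semi-random model) are the $N=Kn$ points $d_i^{(k)}=U_kb_i^{(k)}$, $1\le k\le K$, $1\le i\le n$, where the $b_i^{(k)}$ are independent and uniformly distributed on the unit sphere $\mathbb S^{m-1}$; let $D\in\mathbb R^{M\times N}$ be the matrix with these points as columns. For subspaces $V,W$ let $\mathrm{aff}_\infty(V,W)$ be the cosine of their smallest principal angle. Let $t_1,t_2$ be such that $\mathrm{aff}_\infty(\mathrm{span}\,\hat U_k,\sum_{i\neq k}\mathrm{span}\,\hat U_i)\le t_1$ for all $k$ and $\mathrm{aff}_\infty(\mathrm{span}\,\hat U_i,\mathrm{span}\,\hat U_j)\le t_2$ for all $i\ne j$ (for example, the smallest such numbers), and let $0<t_3<1$ be a constant. Put $$h_1=\sqrt{\tfrac2\pi}\,\frac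 n{\sqrt m}-2\sqrt n-\sqrt{\frac{2n\log n}{m-1}},\qquad h_2=\frac n{\sqrt m}+2\sqrt n+\sqrt{\frac{2n\log n}{m-1}},$$ $$\zeta=\frac{(m-s)\,[t_3^2-(K-1)t_2^2]}{s(1-t_3^2)},\qquad \epsilon=\frac{-\big(\sqrt s+\frac{\zeta s}{\sqrt{m-s}}\big)+\sqrt{\big(\sqrt s+\frac{\zeta s}{\sqrt{m-s}}\big)^2+2s(\zeta-1)}}2 .$$ Assume $$h_1\sqrt{1-(K-2)t_2}\ \ge\ h_2\Big(\sqrt{\tfrac{t_3^2}{1-t_3^2}}+t_1\Big),\qquad h_1\sqrt{K-1}\ \ge\ h_2\Big(\sqrt{\tfrac{t_3^2}{1-t_3^2}}+1\Big),\qquad \zeta>1$$ (in particular all these expressions are meaningful, so $1\le s<m$). Then with probability at least $1-\frac2n-2Ne^{-\epsilon^2}$ the following holds. For every data point $d=d_i^{(k)}$ the problem $\min\|c^TD\|_1$ subject to $c^Td=1$ has an optimal point, and every optimal point $c$ yields a proper affinity vector: all data points that correspond to nonzero entries of $c^TD$ lie in $S_k$. Moreover iPursuit constructs an error-less affinity matrix: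 whenever $C$ is an optimal solution of $\min\|C^TD\|_1$ (entrywise $\ell_1$ norm) subject to $\mathrm{diag}(C^TD)=\mathbf 1$, and $W$ is obtained from $|C^TD|$ by keeping some (possibly all) of its entries and setting the others to zero, the matrix $W+W^T$ has zero entries at all pairs of data points of different clusters (and such $C$ exist). -/

import Mathlib

open MeasureTheory ProbabilityTheory

noncomputable section

/-! ### The iPursuit algorithm

A data matrix with columns `d i ∈ ℝ^M`, `i : ι`, is given by its family of columns. -/

section IPursuit

variable {M : ℕ} {ι κ : Type*} [Fintype ι]

/-- The cost `‖cᵀ D‖₁` of a direction `c`. -/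
def innovationCost (d : ι → EuclideanSpace ℝ (Fin M)) (c : EuclideanSpace ℝ (Fin M)) : ℝ :=
  ∑ j, |inner ℝ c (d j)|

/-- `c` is an optimal point of `min ‖cᵀ D‖₁` subject to `cᵀ dᵢ = 1`, i.e. an optimal direction
(direction of innovation) corresponding to the data point `dᵢ`. -/
def IsOptimalDirection (d : ι → EuclideanSpace ℝ (Fin M)) (i : ι)
    (c : EuclideanSpace ℝ (Fin M)) : Prop :=
  inner ℝ c (d i) = 1 ∧
    ∀ c' : EuclideanSpace ℝ (Fin M), inner ℝ c' (d i) = 1 →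
      innovationCost d c ≤ innovationCost d c'

/-- A direction `c` (computed for a point of a cluster with span `S`) yields a proper affinity
vector: all the data points corresponding to nonzero entries of `cᵀ D` lie in `S`. -/
def YieldsProperAffinity (d : ι → EuclideanSpace ℝ (Fin M))
    (S : Submodule ℝ (EuclideanSpace ℝ (Fin M))) (c : EuclideanSpace ℝ (Fin M)) : Prop :=
  ∀ j, inner ℝ c (d j) ≠ 0 → d j ∈ S

/-- The matrix `C` with columns `C i` is an optimal solution of
`min ‖Cᵀ D‖₁` (entrywise norm) subject to `diag (Cᵀ D) = 1`. -/
def IsIPursuitSolution (d C : ι → EuclideanSpace ℝ (Fin M)) : Prop :=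
  (∀ i, inner ℝ (C i) (d i) = 1) ∧
    ∀ C' : ι → EuclideanSpace ℝ (Fin M), (∀ i, inner ℝ (C' i) (d i) = 1) →
      ∑ i, innovationCost d (C i) ≤ ∑ i, innovationCost d (C' i)

/-- `A` is an affinity (adjacency) matrix built by iPursuit from the data: `A = W + Wᵀ`, where `W`
arises from `|Cᵀ D|`, `C` an optimal solution, by keeping some of the entries (possibly all) and
replacing the others by zero. -/
def IsIPursuitAffinity (d : ι → EuclideanSpace ℝ (Fin M)) (A : Matrix ι ι ℝ) : Prop :=
  ∃ C : ι → EuclideanSpace ℝ (Fin M), IsIPursuitSolution d C ∧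
    ∃ W : Matrix ι ι ℝ, (∀ i j, W i j = |inner ℝ (C i) (d j)| ∨ W i j = 0) ∧
      A = W + W.transpose

/-- The affinity matrix is error-less: the affinity of any two data points in different clusters
is zero. -/
def IsErrorless (cluster : ι → κ) (A : Matrix ι ι ℝ) : Prop :=
  ∀ i j, cluster i ≠ cluster j → A i j = 0

/-- All the optimal directions (which exist) yield proper affinity vectors, and iPursuit constructs
an error-less affinity matrix. Here `S k` is the span of cluster `k`. -/
def IPursuitSucceeds (d : ι → EuclideanSpace ℝ (Fin M))
    (S : κ → Submodule ℝ (EuclideanSpace ℝ (Fin M))) (cluster : ι → κ) : Prop :=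
  (∀ i, (∃ c, IsOptimalDirection d i c) ∧
    ∀ c, IsOptimalDirection d i c → YieldsProperAffinity d (S (cluster i)) c) ∧
  (∃ A, IsIPursuitAffinity d A) ∧
  ∀ A, IsIPursuitAffinity d A → IsErrorless cluster A

end IPursuit

/-! ### The subspaces and their affinities -/

section Subspaces

variable {M K s r : ℕ}

/-- `aff_∞`, the cosine of the smallest principal angle between two subspaces,
i.e. the largest inner product of a unit vector of the one and a unit vector of the other
(`0` if one of the subspaces is trivial). -/
def affInf (W₁ W₂ : Submodule ℝ (EuclideanSpace ℝ (Fin M))) : ℝ :=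
  sSup {a : ℝ | ∃ x ∈ W₁, ∃ y ∈ W₂, ‖x‖ = 1 ∧ ‖y‖ = 1 ∧ a = inner ℝ x y}

/-- The columns of the basis matrix `U_k = [U, Û_k]` of the `k`-th subspace. -/
def subspaceBasis (U : Fin s → EuclideanSpace ℝ (Fin M))
    (Uhat : Fin K → Fin r → EuclideanSpace ℝ (Fin M)) (k : Fin K) :
    Fin s ⊕ Fin r → EuclideanSpace ℝ (Fin M) :=
  Sum.elim U (Uhat k)

/-- The `k`-th subspace `S_k = span U_k`. -/
def clusterSpan (U : Fin s → EuclideanSpace ℝ (Fin M))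
    (Uhat : Fin K → Fin r → EuclideanSpace ℝ (Fin M)) (k : Fin K) :
    Submodule ℝ (EuclideanSpace ℝ (Fin M)) :=
  Submodule.span ℝ (Set.range (subspaceBasis U Uhat k))

/-- The innovation component `span Û_k`. -/
def innovationSpan (Uhat : Fin K → Fin r → EuclideanSpace ℝ (Fin M)) (k : Fin K) :
    Submodule ℝ (EuclideanSpace ℝ (Fin M)) :=
  Submodule.span ℝ (Set.range (Uhat k))

/-- The Innovation Assumption: no subspace is contained in the sum of the others. -/
def InnovationAssumption {E : Type*} [AddCommGroup E] [Module ℝ E]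
    (S : Fin K → Submodule ℝ E) : Prop :=
  ∀ k, ¬ (S k ≤ ⨆ j ∈ {j : Fin K | j ≠ k}, S j)

/-- The uniform probability measure on the unit sphere of `ℝ^ι`: the normalized surface measure. -/
def uniformOnSphere (ι : Type*) [Fintype ι] :
    Measure (Metric.sphere (0 : EuclideanSpace ℝ ι) 1) :=
  ((volume : Measure (EuclideanSpace ℝ ι)).toSphere Set.univ)⁻¹ •
    (volume : Measure (EuclideanSpace ℝ ι)).toSphere

/-- The data points `d_i^(k) = U_k b_i^(k)`, indexed by the pair `(k, i)`. -/
def dataPoints {n : ℕ} (U : Fin s → EuclideanSpace ℝ (Fin M))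
    (Uhat : Fin K → Fin r → EuclideanSpace ℝ (Fin M))
    (b : Fin K × Fin n → EuclideanSpace ℝ (Fin s ⊕ Fin r)) (p : Fin K × Fin n) :
    EuclideanSpace ℝ (Fin M) :=
  ∑ j, b p j • subspaceBasis U Uhat p.1 j

end Subspaces

/-! ### The explicit quantities -/

/-- `h₁ = √(2/π) n/√m - 2√n - √(2 n log n/(m-1))`. -/
def hLower (n m : ℕ) : ℝ :=
  √(2 / Real.pi) * (n / √m) - 2 * √n - √(2 * n * Real.log n / ((m : ℝ) - 1))

/-- `h₂ = n/√m + 2√n + √(2 n log n/(m-1))`. -/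
def hUpper (n m : ℕ) : ℝ :=
  n / √m + 2 * √n + √(2 * n * Real.log n / ((m : ℝ) - 1))

/-- `ζ = (m-s) [t₃² - (K-1) t₂²] / (s (1-t₃²))`. -/
def zetaRatio (K m s : ℕ) (t₂ t₃ : ℝ) : ℝ :=
  ((m : ℝ) - s) * (t₃ ^ 2 - ((K : ℝ) - 1) * t₂ ^ 2) / (s * (1 - t₃ ^ 2))

/-- `ε = -(√s + ζ s/√(m-s))/2 + √((√s + ζ s/√(m-s))² + 2 s (ζ-1))/2`. -/
def epsRate (m s : ℕ) (ζ : ℝ) : ℝ :=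
  -(√s + ζ * s / √((m : ℝ) - s)) / 2 +
    √((√s + ζ * s / √((m : ℝ) - s)) ^ 2 + 2 * s * (ζ - 1)) / 2

end

/-! ### Optimal directions -/

section OptimalDirections

variable {M : ℕ} {ι κ : Type*} [Fintype ι]

/-! The deterministic core is `iPursuitSucceeds_of_bounds`, an exchange argument. Let c be optimal
for a point of cluster k and put p = ‖Uᵀc‖. As the innovation spans are independent, there is a
competitor c' that is orthogonal to U and to the other innovation spans and that copies c on Û_k, up
to a correction along the innovation part of the point which restores the constraint. If the common
part of b has squared norm at most q times that of its innovation part, the coordinates in cluster k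
move by at most √(1+q) p. If also H₁‖a‖ ≤ ∑ |⟨a, bᵢ⟩| ≤ H₂‖a‖ in each cluster, the cost in cluster k
grows by at most H₂ √(1+q) p, whereas the cost of c on the other clusters, at least (K-1) H₁ p, is
saved entirely. So H₂ √(1+q) < (K-1) H₁ forces p = 0, and then c vanishes on all points of the other
clusters.

The random inputs come from comparing the sphere with a Gaussian vector in polar coordinates. By
Jensen in the radius, |⟨a, u⟩| times the mean radius has a smaller moment generating function than
|g| (`exists_scale_lintegral_exp_le`). Chernoff's bound on a 1/50-net then gives H₁ and H₂
(`exists_bounds`); only their ratio matters, so the scale cancels. The block ratio is controlled by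
Markov's inequality for an exponential of a quadratic form (`uniformOnSphere_ratio_le`).

With μ = √(2/π) and x = √(n/m), one has h₁/h₂ ≤ y = (μx-2)/(x+2). The assumptions yield √q ≤ y and
1+√q ≤ y√(K-1) for q = ζs/(m-s). The exchange argument is run with 3q: since √(1+3q) ≤ (1+√q)² ≤
y²(K-1), the weak bound H₁/H₂ > y² suffices. It leaves room for the crude net constants, so that
every bad event has probability at most a small multiple of exp(-ε²). -/

theorem exists_isOptimalDirection (d : ι → EuclideanSpace ℝ (Fin M)) (i : ι) (hd : d i ≠ 0) :
    ∃ c, IsOptimalDirection d i c := by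
  let T : EuclideanSpace ℝ (Fin M) →ₗ[ℝ] (ι → ℝ) :=
    LinearMap.pi fun j => (innerₗ (EuclideanSpace ℝ (Fin M))).flip (d j)
  have hT : ∀ c j, T c j = inner ℝ c (d j) := fun c j => rfl
  -- Minimise over the vectors cᵀD instead of over c: the ℓ₁ norm is coercive there, even if
  -- directions orthogonal to all the data exist.
  let s : Set (ι → ℝ) := (LinearMap.range T : Set (ι → ℝ)) ∩ {y | y i = 1}
  have hs : IsClosed s := (Submodule.closed_of_finiteDimensional _).inter
    (isClosed_eq (continuous_apply i) continuous_const)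
  have hcont : Continuous fun y : ι → ℝ => ∑ j, |y j| := by fun_prop
  have hmem : T ((‖d i‖ ^ 2)⁻¹ • d i) ∈ s := by
    refine ⟨⟨_, rfl⟩, ?_⟩
    have : ‖d i‖ ≠ 0 := norm_ne_zero_iff.mpr hd
    simp only [Set.mem_ofPred_eq, hT, inner_smul_left, real_inner_self_eq_norm_sq]
    simp [this]
  obtain ⟨y, ⟨⟨c, rfl⟩, hy⟩, hmin⟩ := hcont.continuousOn.exists_isMinOn' hs hmem (by
    refine Filter.Eventually.filter_mono inf_le_left ?_
    filter_upwards [(tendsto_norm_cocompact_atTop (E := ι → ℝ)).eventually_ge_atTop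
      (∑ j, |T ((‖d i‖ ^ 2)⁻¹ • d i) j|)] with y hy
    refine hy.trans ((pi_norm_le_iff_of_nonneg (by positivity)).mpr fun j => ?_)
    exact Finset.single_le_sum (f := fun j => |y j|) (fun _ _ => abs_nonneg _)
      (Finset.mem_univ j))
  refine ⟨c, hy, fun c' hc' => ?_⟩
  exact hmin (show T c' ∈ s from ⟨⟨_, rfl⟩, hc'⟩)

/-- The joint problem decouples into the problems of the single data points. -/
theorem IsIPursuitSolution.isOptimalDirection {d C : ι → EuclideanSpace ℝ (Fin M)}
    (hC : IsIPursuitSolution d C) (i : ι) : IsOptimalDirection d i (C i) := by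
  classical
  refine ⟨hC.1 i, fun c' hc' => ?_⟩
  have h := hC.2 (Function.update C i c') fun j => by
    by_cases hj : j = i
    · subst hj; simpa using hc'
    · simpa [hj] using hC.1 j
  rw [← Finset.add_sum_erase _ _ (Finset.mem_univ i),
    ← Finset.add_sum_erase _ _ (Finset.mem_univ i)] at h
  have h2 : ∑ j ∈ Finset.univ.erase i, innovationCost d (Function.update C i c' j) =
      ∑ j ∈ Finset.univ.erase i, innovationCost d (C j) :=
    Finset.sum_congr rfl fun j hj => by simp [Finset.ne_of_mem_erase hj]
  rw [h2, Function.update_self] at h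
  exact le_of_add_le_add_right h

theorem iPursuitSucceeds_of_forall_inner_eq_zero (d : ι → EuclideanSpace ℝ (Fin M))
    (S : κ → Submodule ℝ (EuclideanSpace ℝ (Fin M))) (cluster : ι → κ)
    (hd : ∀ i, d i ≠ 0) (hS : ∀ i, d i ∈ S (cluster i))
    (h : ∀ i c, IsOptimalDirection d i c → ∀ j, cluster j ≠ cluster i → inner ℝ c (d j) = 0) :
    IPursuitSucceeds d S cluster := by
  refine ⟨fun i => ⟨exists_isOptimalDirection d i (hd i), fun c hc j hj => ?_⟩, ?_, ?_⟩
  · have : cluster j = cluster i := by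
      by_contra hne
      exact hj (h i c hc j hne)
    exact this ▸ hS j
  · choose C hC using fun i => exists_isOptimalDirection d i (hd i)
    exact ⟨_, C, ⟨fun i => (hC i).1, fun C' hC' => Finset.sum_le_sum fun i _ =>
      (hC i).2 _ (hC' i)⟩, _, fun i j => Or.inl rfl, rfl⟩
  · rintro A ⟨C, hC, W, hW, rfl⟩ i j hij
    have hzero : ∀ i j, cluster i ≠ cluster j → W i j = 0 := fun i j hij => by
      rcases hW i j with h1 | h1
      · rw [h1, h i _ (hC.isOptimalDirection i) j hij.symm, abs_zero]
      · exact h1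
    simp [Matrix.add_apply, Matrix.transpose_apply, hzero i j hij, hzero j i hij.symm]

end OptimalDirections

/-! ### The deterministic condition -/

section Deterministic

/-- The family stays independent in the quotient by `V`, so a functional on the quotient has the
prescribed values; its pullback is represented by a vector. This supplies the competitor in the
exchange argument. -/
theorem exists_inner_eq_of_disjoint {E : Type*} [NormedAddCommGroup E] [InnerProductSpace ℝ E]
    [FiniteDimensional ℝ E] {ι : Type*} (V : Submodule ℝ E) (v : ι → E)
    (hv : LinearIndependent ℝ v) (hd : Disjoint (Submodule.span ℝ (Set.range v)) V) (y : ι → ℝ) :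
    ∃ c : E, (∀ x ∈ V, inner ℝ c x = 0) ∧ ∀ l, inner ℝ c (v l) = y l := by
  have hw : LinearIndependent ℝ (V.mkQ ∘ v) := hv.map (by rwa [Submodule.ker_mkQ])
  obtain ⟨g, hg⟩ := LinearMap.exists_extend ((Module.Basis.span hw).constr ℝ y)
  have hgv : ∀ l, g (V.mkQ (v l)) = y l := fun l => by
    have h2 := LinearMap.congr_fun hg (Module.Basis.span hw l)
    rw [Module.Basis.constr_basis] at h2
    rw [← h2, Module.Basis.span_apply hw l]
    rfl
  let φ : E →L[ℝ] ℝ := LinearMap.toContinuousLinearMap (g ∘ₗ V.mkQ)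
  have hφ : ∀ x, inner ℝ ((InnerProductSpace.toDual ℝ E).symm φ) x = g (V.mkQ x) := fun x => by
    rw [InnerProductSpace.toDual_symm_apply]; rfl
  refine ⟨(InnerProductSpace.toDual ℝ E).symm φ, fun x hx => ?_, fun l => ?_⟩
  · rw [hφ, (Submodule.Quotient.mk_eq_zero V).mpr hx |> fun h => (show V.mkQ x = 0 from h), map_zero]
  · rw [hφ, hgv]

variable {M K s r n : ℕ} {U : Fin s → EuclideanSpace ℝ (Fin M)}
  {Uhat : Fin K → Fin r → EuclideanSpace ℝ (Fin M)}

/-- The coordinates `U_kᵀ c`. -/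
noncomputable def analysisCoeff (U : Fin s → EuclideanSpace ℝ (Fin M))
    (Uhat : Fin K → Fin r → EuclideanSpace ℝ (Fin M)) (k : Fin K) (c : EuclideanSpace ℝ (Fin M)) :
    EuclideanSpace ℝ (Fin s ⊕ Fin r) :=
  WithLp.toLp 2 fun j => inner ℝ c (subspaceBasis U Uhat k j)

theorem inner_dataPoints (b : Fin K × Fin n → EuclideanSpace ℝ (Fin s ⊕ Fin r))
    (c : EuclideanSpace ℝ (Fin M)) (p : Fin K × Fin n) :
    inner ℝ c (dataPoints U Uhat b p) = inner ℝ (analysisCoeff U Uhat p.1 c) (b p) := by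
  rw [dataPoints, inner_sum, PiLp.inner_apply]
  simp only [inner_smul_right]
  rfl

theorem inner_analysisCoeff (k : Fin K) (c : EuclideanSpace ℝ (Fin M))
    (x : EuclideanSpace ℝ (Fin s ⊕ Fin r)) :
    inner ℝ (analysisCoeff U Uhat k c) x =
      ∑ l, inner ℝ c (U l) * x (Sum.inl l) + ∑ l, inner ℝ c (Uhat k l) * x (Sum.inr l) := by
  rw [PiLp.inner_apply, Fintype.sum_sum_type]
  congr 1 <;> exact Finset.sum_congr rfl fun l _ => mul_comm _ _

theorem norm_dataPoints (hU : ∀ k, Orthonormal ℝ (subspaceBasis U Uhat k))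
    (b : Fin K × Fin n → EuclideanSpace ℝ (Fin s ⊕ Fin r)) (p : Fin K × Fin n) :
    ‖dataPoints U Uhat b p‖ = ‖b p‖ := by
  have h : ‖dataPoints U Uhat b p‖ ^ 2 = ‖b p‖ ^ 2 := by
    rw [← real_inner_self_eq_norm_sq, EuclideanSpace.real_norm_sq_eq]
    unfold dataPoints
    rw [(hU p.1).inner_sum]
    simp [pow_two]
  exact (pow_left_inj₀ (norm_nonneg _) (norm_nonneg _) two_ne_zero).mp h

theorem dataPoints_mem_clusterSpan (b : Fin K × Fin n → EuclideanSpace ℝ (Fin s ⊕ Fin r))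
    (p : Fin K × Fin n) : dataPoints U Uhat b p ∈ clusterSpan U Uhat p.1 :=
  Submodule.sum_mem _ fun j _ => Submodule.smul_mem _ _ (Submodule.subset_span ⟨j, rfl⟩)

theorem clusterSpan_eq_sup (k : Fin K) :
    clusterSpan U Uhat k = Submodule.span ℝ (Set.range U) ⊔ innovationSpan Uhat k := by
  rw [clusterSpan, subspaceBasis, Set.Sum.elim_range, Submodule.span_union, innovationSpan]

theorem span_isOrtho_innovationSpan (hU : ∀ k, Orthonormal ℝ (subspaceBasis U Uhat k))
    (k : Fin K) : Submodule.span ℝ (Set.range U) ⟂ innovationSpan Uhat k := by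
  rw [innovationSpan, Submodule.isOrtho_span]
  rintro _ ⟨i, rfl⟩ _ ⟨j, rfl⟩
  exact (hU k).2 (i := Sum.inl i) (j := Sum.inr j) (by simp)

/-- If the innovation components are independent, so are the innovation component of a cluster and
the span of the other clusters. -/
theorem disjoint_innovationSpan (hU : ∀ k, Orthonormal ℝ (subspaceBasis U Uhat k)) (k : Fin K)
    (hd : Disjoint (innovationSpan Uhat k)
      (⨆ j ∈ {j : Fin K | j ≠ k}, innovationSpan Uhat j)) :
    Disjoint (innovationSpan Uhat k) (Submodule.span ℝ (Set.range U) ⊔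
      ⨆ j ∈ {j : Fin K | j ≠ k}, innovationSpan Uhat j) := by
  rw [Submodule.disjoint_def] at hd ⊢
  intro x hx hx'
  obtain ⟨u, hu, v, hv, rfl⟩ := Submodule.mem_sup.mp hx'
  have h1 : Submodule.span ℝ (Set.range U) ⟂
      ⨆ j ∈ {j : Fin K | j ≠ k}, innovationSpan Uhat j := by
    simp only [Submodule.isOrtho_iSup_right]
    exact fun j _ => span_isOrtho_innovationSpan hU j
  have h2 : inner ℝ u (u + v) = 0 := (span_isOrtho_innovationSpan hU k).inner_eq hu hx
  rw [inner_add_right, h1.inner_eq hu hv, add_zero, inner_self_eq_zero] at h2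
  subst h2
  rw [zero_add] at hx ⊢
  exact hd v hx hv

theorem iPursuitSucceeds_of_bounds (hU : ∀ k, Orthonormal ℝ (subspaceBasis U Uhat k))
    (hd : ∀ k, Disjoint (innovationSpan Uhat k)
      (⨆ j ∈ {j : Fin K | j ≠ k}, innovationSpan Uhat j))
    (b : Fin K × Fin n → EuclideanSpace ℝ (Fin s ⊕ Fin r)) (hb : ∀ p, ‖b p‖ = 1)
    {H₁ H₂ q : ℝ} (hH₁ : 0 < H₁) (hH₂ : 0 ≤ H₂) (hq : 0 ≤ q)
    (hlow : ∀ k a, H₁ * ‖a‖ ≤ ∑ i, |inner ℝ a (b (k, i))|)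
    (hup : ∀ k a, ∑ i, |inner ℝ a (b (k, i))| ≤ H₂ * ‖a‖)
    (hratio : ∀ p, ∑ i, b p (Sum.inl i) ^ 2 ≤ q * ∑ j, b p (Sum.inr j) ^ 2)
    (hH : H₂ * √(1 + q) < ((K : ℝ) - 1) * H₁) :
    IPursuitSucceeds (dataPoints U Uhat b) (clusterSpan U Uhat) Prod.fst := by
  refine iPursuitSucceeds_of_forall_inner_eq_zero _ _ _ (fun p => ?_)
    (dataPoints_mem_clusterSpan b) ?_
  · rw [← norm_ne_zero_iff, norm_dataPoints hU, hb]; exact one_ne_zero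
  rintro ⟨k, i⟩ c ⟨hc1, hcmin⟩
  set β := ∑ j, b (k, i) (Sum.inr j) ^ 2 with hβ
  have hβpos : 0 < β := by
    have h1 : ‖b (k, i)‖ ^ 2 = 1 := by rw [hb, one_pow]
    rw [EuclideanSpace.real_norm_sq_eq, Fintype.sum_sum_type] at h1
    have h2 := hratio (k, i)
    -- If β vanished, the ratio bound would make the common block vanish too, contradicting that b
    -- is a unit vector.
    by_contra hneg
    have h3 : q * β ≤ 0 := mul_nonpos_of_nonneg_of_nonpos hq (not_lt.mp hneg)
    linarith
  set σ := ∑ l, inner ℝ c (U l) * b (k, i) (Sum.inl l) with hσ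
  set π2 := ∑ l, inner ℝ c (U l) ^ 2 with hπ2
  have hσπ : σ ^ 2 ≤ q * β * π2 := by
    refine (Finset.sum_mul_sq_le_sq_mul_sq _ _ _).trans ?_
    rw [mul_comm]
    exact mul_le_mul_of_nonneg_right (hratio (k, i)) (by positivity)
  have hlin : LinearIndependent ℝ (Uhat k) :=
    (hU k).linearIndependent.comp Sum.inr Sum.inr_injective
  -- The competitor. Passing to it loses the contribution σ of the common block to cᵀd; the multiple
  -- σ/β of the innovation block, of squared norm β, restores exactly σ.
  obtain ⟨c', hc'V, hc'k⟩ := exists_inner_eq_of_disjoint _ (Uhat k) hlin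
    (disjoint_innovationSpan hU k (hd k))
    fun l => inner ℝ c (Uhat k l) + σ / β * b (k, i) (Sum.inr l)
  have hc'U : ∀ l, inner ℝ c' (U l) = 0 := fun l =>
    hc'V _ (Submodule.mem_sup_left (Submodule.subset_span ⟨l, rfl⟩))
  have hc'd : ∀ p : Fin K × Fin n, p.1 ≠ k → inner ℝ c' (dataPoints U Uhat b p) = 0 :=
    fun p hp => hc'V _ (by
      have h1 := dataPoints_mem_clusterSpan (U := U) (Uhat := Uhat) b p
      rw [clusterSpan_eq_sup] at h1
      exact sup_le_sup_left (le_iSup₂_of_le (f := fun j (_ : j ∈ {j : Fin K | j ≠ k}) =>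
        innovationSpan Uhat j) p.1 hp le_rfl) _ h1)
  have hc'1 : inner ℝ c' (dataPoints U Uhat b (k, i)) = 1 := by
    rw [← hc1, inner_dataPoints, inner_dataPoints]
    simp only [inner_analysisCoeff, hc'U, hc'k, zero_mul, Finset.sum_const_zero, zero_add, add_mul,
      Finset.sum_add_distrib]
    have h1 : ∑ l, σ / β * b (k, i) (Sum.inr l) * b (k, i) (Sum.inr l) = σ := by
      simp only [mul_assoc, ← pow_two, ← Finset.mul_sum]
      exact div_mul_cancel₀ σ hβpos.ne'
    rw [h1, hσ, add_comm]
  have hcost : ∀ c, innovationCost (dataPoints U Uhat b) c =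
      ∑ k, ∑ i, |inner ℝ (analysisCoeff U Uhat k c) (b (k, i))| := fun c => by
    simp only [innovationCost, inner_dataPoints, Fintype.sum_prod_type]
  have hdiff : ‖analysisCoeff U Uhat k c' - analysisCoeff U Uhat k c‖ ≤ √(1 + q) * √π2 := by
    rw [← Real.sqrt_mul (by positivity)]
    refine Real.le_sqrt_of_sq_le ?_
    rw [EuclideanSpace.real_norm_sq_eq, Fintype.sum_sum_type]
    simp only [analysisCoeff, subspaceBasis, PiLp.sub_apply, Sum.elim_inl, Sum.elim_inr, hc'U,
      hc'k, zero_sub, neg_sq, add_sub_cancel_left, mul_pow, ← Finset.mul_sum]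
    rw [← hπ2, ← hβ]
    -- The correction has squared norm σ²/β, at most q π2 by Cauchy–Schwarz and the ratio bound;
    -- dropping Uᵀc adds π2.
    have h1 : (σ / β) ^ 2 * β ≤ q * π2 := by
      rw [div_pow, div_mul_eq_mul_div, div_le_iff₀ (by positivity)]
      nlinarith
    linarith
  have hk : ∑ i, |inner ℝ (analysisCoeff U Uhat k c') (b (k, i))| ≤
      ∑ i, |inner ℝ (analysisCoeff U Uhat k c) (b (k, i))| + H₂ * (√(1 + q) * √π2) := by
    have h1 := (hup k (analysisCoeff U Uhat k c' - analysisCoeff U Uhat k c)).trans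
      (mul_le_mul_of_nonneg_left hdiff hH₂)
    refine le_trans ?_ (add_le_add_right h1 _)
    rw [← Finset.sum_add_distrib]
    refine Finset.sum_le_sum fun i _ => ?_
    rw [inner_sub_left]
    have := abs_add_le (inner ℝ (analysisCoeff U Uhat k c) (b (k, i)))
      (inner ℝ (analysisCoeff U Uhat k c') (b (k, i)) -
        inner ℝ (analysisCoeff U Uhat k c) (b (k, i)))
    rwa [add_sub_cancel] at this
  have hopt := hcmin c' hc'1
  rw [hcost, hcost, ← Finset.add_sum_erase _ _ (Finset.mem_univ k),
    ← Finset.add_sum_erase _ (fun k => ∑ i, |inner ℝ (analysisCoeff U Uhat k c') (b (k, i))|)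
      (Finset.mem_univ k)] at hopt
  have hz : ∑ x ∈ Finset.univ.erase k, ∑ i, |inner ℝ (analysisCoeff U Uhat x c') (b (x, i))| = 0 :=
    Finset.sum_eq_zero fun x hx => Finset.sum_eq_zero fun i _ => by
      rw [← inner_dataPoints b c' (x, i), hc'd _ (Finset.ne_of_mem_erase hx), abs_zero]
  have hothers : ∑ x ∈ Finset.univ.erase k, ∑ i, |inner ℝ (analysisCoeff U Uhat x c) (b (x, i))| ≤
      H₂ * (√(1 + q) * √π2) := by linarith
  have hge : ((K : ℝ) - 1) * (H₁ * √π2) ≤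
      ∑ x ∈ Finset.univ.erase k, ∑ i, |inner ℝ (analysisCoeff U Uhat x c) (b (x, i))| := by
    have h1 := Finset.card_nsmul_le_sum (Finset.univ.erase k)
      -- The coordinates of c in every cluster contain the common block Uᵀc, of norm √π2.
      (fun x => ∑ i, |inner ℝ (analysisCoeff U Uhat x c) (b (x, i))|) (H₁ * √π2) fun x _ => by
        refine le_trans (mul_le_mul_of_nonneg_left ?_ hH₁.le) (hlow x _)
        refine (Real.sqrt_le_left (norm_nonneg _)).mpr ?_
        rw [EuclideanSpace.real_norm_sq_eq, Fintype.sum_sum_type]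
        exact le_add_of_nonneg_right (by positivity)
    rw [Finset.card_erase_of_mem (Finset.mem_univ k), Finset.card_univ, Fintype.card_fin,
      nsmul_eq_mul, Nat.cast_sub (Nat.one_le_of_lt k.2), Nat.cast_one] at h1
    exact h1
  have hπ0 : √π2 = 0 := by
    by_contra hne
    have hpos : 0 < √π2 := lt_of_le_of_ne (Real.sqrt_nonneg _) (Ne.symm hne)
    nlinarith [mul_lt_mul_of_pos_right hH hpos]
  rw [hπ0, mul_zero, mul_zero] at hothers
  rintro ⟨x, j⟩ hxk
  have h0 := (Finset.sum_eq_zero_iff_of_nonneg fun x _ => Finset.sum_nonneg fun i _ =>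
    abs_nonneg (inner ℝ (analysisCoeff U Uhat x c) (b (x, i)))).mp
    (le_antisymm hothers (Finset.sum_nonneg fun x _ => Finset.sum_nonneg fun i _ => abs_nonneg _))
    x (Finset.mem_erase.mpr ⟨hxk, Finset.mem_univ x⟩)
  have h1 := (Finset.sum_eq_zero_iff_of_nonneg fun i _ => abs_nonneg _).mp h0 j (Finset.mem_univ j)
  rw [inner_dataPoints]
  exact abs_eq_zero.mp h1

end Deterministic

/-! ### Gaussian integrals over Euclidean spaces and the uniform measure on the sphere -/

section Polar

variable {ι : Type*} [Fintype ι]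

theorem integral_prod_euclideanSpace (f : ι → ℝ → ℝ) :
    ∫ x : EuclideanSpace ℝ ι, ∏ i, f i (x i) = ∏ i, ∫ t, f i t := by
  rw [← integral_fintype_prod_volume_eq_prod,
    ← (PiLp.volume_preserving_toLp ι).integral_comp
      (MeasurableEquiv.toLp 2 (ι → ℝ)).measurableEmbedding]

theorem integrable_prod_euclideanSpace {f : ι → ℝ → ℝ} (hf : ∀ i, Integrable (f i)) :
    Integrable fun x : EuclideanSpace ℝ ι => ∏ i, f i (x i) := by
  rw [← (PiLp.volume_preserving_toLp ι).integrable_comp_emb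
      (MeasurableEquiv.toLp 2 (ι → ℝ)).measurableEmbedding]
  exact Integrable.fintype_prod hf

theorem exp_neg_mul_norm_sq (c : ℝ) (x : EuclideanSpace ℝ ι) :
    Real.exp (-c * ‖x‖ ^ 2) = ∏ i, Real.exp (-c * x i ^ 2) := by
  rw [EuclideanSpace.real_norm_sq_eq, Finset.mul_sum, Real.exp_sum]

theorem integrable_exp_neg_mul_norm_sq {c : ℝ} (hc : 0 < c) :
    Integrable fun x : EuclideanSpace ℝ ι => Real.exp (-c * ‖x‖ ^ 2) := by
  simp only [exp_neg_mul_norm_sq]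
  exact integrable_prod_euclideanSpace (f := fun _ t => Real.exp (-c * t ^ 2))
    fun _ => integrable_exp_neg_mul_sq hc

theorem lintegral_exp_neg_half_norm_sq :
    ∫⁻ x : EuclideanSpace ℝ ι, ENNReal.ofReal (Real.exp (-(1 / 2) * ‖x‖ ^ 2)) =
      ENNReal.ofReal (√(2 * Real.pi) ^ Fintype.card ι) := by
  rw [← ofReal_integral_eq_lintegral_ofReal (integrable_exp_neg_mul_norm_sq (by norm_num))
    (Filter.Eventually.of_forall fun x => (Real.exp_pos _).le)]
  simp only [exp_neg_mul_norm_sq]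
  rw [integral_prod_euclideanSpace (fun _ t => Real.exp (-(1 / 2) * t ^ 2))]
  simp only [integral_gaussian, Finset.prod_const, Finset.card_univ]
  congr 4
  field_simp

variable [Nonempty ι]

theorem lintegral_eq_lintegral_toSphere {f : EuclideanSpace ℝ ι → ENNReal} (hf : Measurable f) :
    ∫⁻ x, f x = ∫⁻ u, ∫⁻ t : Set.Ioi (0 : ℝ), f (t.1 • u.1)
      ∂(Measure.volumeIoiPow (Module.finrank ℝ (EuclideanSpace ℝ ι) - 1))
      ∂(volume : Measure (EuclideanSpace ℝ ι)).toSphere := by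
  have hmp := (volume : Measure (EuclideanSpace ℝ ι)).measurePreserving_homeomorphUnitSphereProd
  have hg : Measurable fun p : Metric.sphere (0 : EuclideanSpace ℝ ι) 1 × Set.Ioi (0 : ℝ) =>
      f (p.2.1 • p.1.1) := by fun_prop
  rw [← lintegral_prod _ hg.aemeasurable, ← hmp.lintegral_comp hg]
  have h1 : ∀ x : ({0}ᶜ : Set (EuclideanSpace ℝ ι)),
      f ((homeomorphUnitSphereProd _ x).2.1 • (homeomorphUnitSphereProd _ x).1.1) = f x := by
    intro x
    have hx : ‖(x : EuclideanSpace ℝ ι)‖ ≠ 0 := norm_ne_zero_iff.mpr x.2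
    simp [smul_smul, hx]
  simp only [h1]
  rw [lintegral_subtype_comap (measurableSet_singleton _).compl, restrict_compl_singleton]

/-- The law of the norm of a standard Gaussian vector of `ℝ^ι`, up to a constant factor. -/
noncomputable def gaussianRadial (ι : Type*) [Fintype ι] : Measure (Set.Ioi (0 : ℝ)) :=
  (Measure.volumeIoiPow (Module.finrank ℝ (EuclideanSpace ℝ ι) - 1)).withDensity
    fun t => ENNReal.ofReal (Real.exp (-(1 / 2) * t.1 ^ 2))

theorem lintegral_mul_exp_eq {f : EuclideanSpace ℝ ι → ENNReal} (hf : Measurable f) :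
    ∫⁻ x, ENNReal.ofReal (Real.exp (-(1 / 2) * ‖x‖ ^ 2)) * f x =
      ∫⁻ u, ∫⁻ t : Set.Ioi (0 : ℝ), f (t.1 • u.1) ∂(gaussianRadial ι)
        ∂(volume : Measure (EuclideanSpace ℝ ι)).toSphere := by
  rw [lintegral_eq_lintegral_toSphere (by fun_prop)]
  refine lintegral_congr fun u => ?_
  rw [gaussianRadial, lintegral_withDensity_eq_lintegral_mul _ (by fun_prop) (by fun_prop)]
  refine lintegral_congr fun t => ?_
  simp [norm_smul]

theorem toSphere_univ_mul_gaussianRadial :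
    (volume : Measure (EuclideanSpace ℝ ι)).toSphere Set.univ * gaussianRadial ι Set.univ =
      ENNReal.ofReal (√(2 * Real.pi) ^ Fintype.card ι) := by
  rw [← lintegral_exp_neg_half_norm_sq]
  have h := lintegral_mul_exp_eq (ι := ι) (f := fun _ => 1) measurable_const
  simp only [mul_one, lintegral_const, one_mul] at h
  rw [h, mul_comm]

theorem toSphere_univ_ne_zero :
    (volume : Measure (EuclideanSpace ℝ ι)).toSphere Set.univ ≠ 0 := by
  rw [Measure.measure_univ_ne_zero]
  exact Measure.toSphere_ne_zero _

theorem gaussianRadial_univ_ne_zero : gaussianRadial ι Set.univ ≠ 0 := by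
  intro h
  have h1 := toSphere_univ_mul_gaussianRadial (ι := ι)
  rw [h, mul_zero] at h1
  exact (ENNReal.ofReal_pos.mpr (by positivity)).ne h1

instance : IsFiniteMeasure (gaussianRadial ι) := by
  refine ⟨?_⟩
  by_contra h
  have h1 := toSphere_univ_mul_gaussianRadial (ι := ι)
  rw [not_lt, top_le_iff] at h
  rw [h, ENNReal.mul_top toSphere_univ_ne_zero] at h1
  exact ENNReal.ofReal_ne_top h1.symm

instance : IsProbabilityMeasure (uniformOnSphere ι) := by
  refine ⟨?_⟩
  rw [uniformOnSphere, Measure.smul_apply, smul_eq_mul,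
    ENNReal.inv_mul_cancel toSphere_univ_ne_zero (measure_ne_top _ _)]

/-- Comparison of the integral of a function on the sphere with a Gaussian integral: it suffices
to compare along the rays. -/
theorem lintegral_uniformOnSphere_mul_le {f : EuclideanSpace ℝ ι → ENNReal} (hf : Measurable f)
    {φ : Metric.sphere (0 : EuclideanSpace ℝ ι) 1 → ENNReal} (hφ : Measurable φ)
    (h : ∀ u, φ u * gaussianRadial ι Set.univ ≤
      ∫⁻ t : Set.Ioi (0 : ℝ), f (t.1 • u.1) ∂(gaussianRadial ι)) :
    (∫⁻ u, φ u ∂(uniformOnSphere ι)) * ENNReal.ofReal (√(2 * Real.pi) ^ Fintype.card ι) ≤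
      ∫⁻ x, ENNReal.ofReal (Real.exp (-(1 / 2) * ‖x‖ ^ 2)) * f x := by
  rw [lintegral_mul_exp_eq hf, ← toSphere_univ_mul_gaussianRadial, uniformOnSphere,
    lintegral_smul_measure, smul_eq_mul]
  refine le_trans (le_of_eq ?_) (lintegral_mono h)
  rw [lintegral_mul_const _ hφ, ← mul_assoc,
    mul_comm _ ((volume : Measure (EuclideanSpace ℝ ι)).toSphere Set.univ), ← mul_assoc,
    ENNReal.mul_inv_cancel toSphere_univ_ne_zero (measure_ne_top _ _), one_mul]

/-- In polar coordinates this is the finiteness of ∫ ‖x‖ exp(-‖x‖²/2), which holds since ‖x‖ ≤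
exp(‖x‖²/4). -/
theorem integrable_gaussianRadial : Integrable (fun t : Set.Ioi (0 : ℝ) => t.1)
    (gaussianRadial ι) := by
  refine ⟨by fun_prop, ?_⟩
  rw [hasFiniteIntegral_iff_ofReal (Filter.Eventually.of_forall fun t => le_of_lt t.2)]
  have h := lintegral_mul_exp_eq (ι := ι) (f := fun x => ENNReal.ofReal ‖x‖) (by fun_prop)
  have h1 : ∀ (u : Metric.sphere (0 : EuclideanSpace ℝ ι) 1) (t : Set.Ioi (0 : ℝ)),
      ‖t.1 • u.1‖ = t.1 := fun u t => by
    rw [norm_smul, norm_eq_of_mem_sphere, mul_one, Real.norm_of_nonneg (le_of_lt t.2)]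
  simp only [h1, lintegral_const] at h
  have h2 : ∫⁻ x : EuclideanSpace ℝ ι, ENNReal.ofReal (Real.exp (-(1 / 2) * ‖x‖ ^ 2)) *
      ENNReal.ofReal ‖x‖ < ⊤ := by
    refine lt_of_le_of_lt (lintegral_mono fun x => ?_)
      (hasFiniteIntegral_iff_ofReal (Filter.Eventually.of_forall fun x => (Real.exp_pos _).le) |>.mp
        (integrable_exp_neg_mul_norm_sq (ι := ι) (c := 1 / 4) (by norm_num)).2)
    rw [← ENNReal.ofReal_mul (Real.exp_pos _).le]
    refine ENNReal.ofReal_le_ofReal ?_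
    have h3 : ‖x‖ ≤ Real.exp (1 / 4 * ‖x‖ ^ 2) := by
      nlinarith [Real.add_one_le_exp (1 / 4 * ‖x‖ ^ 2), sq_nonneg (‖x‖ / 2 - 1)]
    calc _ ≤ Real.exp (-(1 / 2) * ‖x‖ ^ 2) * Real.exp (1 / 4 * ‖x‖ ^ 2) := by gcongr
      _ = _ := by rw [← Real.exp_add]; ring_nf
  rw [h] at h2
  exact lt_top_iff_ne_top.mpr fun htop => by
    rw [htop, ENNReal.top_mul toSphere_univ_ne_zero] at h2
    exact lt_irrefl _ h2

theorem ofReal_exp_integral_le {α : Type*} [MeasurableSpace α] (μ : Measure α)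
    [IsProbabilityMeasure μ] {X : α → ℝ} (hX : Integrable X μ) :
    ENNReal.ofReal (Real.exp (∫ x, X x ∂μ)) ≤ ∫⁻ x, ENNReal.ofReal (Real.exp (X x)) ∂μ := by
  have hm : AEStronglyMeasurable (fun x => Real.exp (X x)) μ :=
    Real.continuous_exp.comp_aestronglyMeasurable hX.1
  by_cases hfin : ∫⁻ x, ENNReal.ofReal (Real.exp (X x)) ∂μ = ⊤
  · rw [hfin]; exact le_top
  have hint : Integrable (fun x => Real.exp (X x)) μ := ⟨hm, by
    rw [hasFiniteIntegral_iff_ofReal (Filter.Eventually.of_forall fun x => (Real.exp_pos _).le)]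
    exact lt_top_iff_ne_top.mpr hfin⟩
  rw [← ofReal_integral_eq_lintegral_ofReal hint
    (Filter.Eventually.of_forall fun x => (Real.exp_pos _).le)]
  exact ENNReal.ofReal_le_ofReal (convexOn_exp.map_integral_le Real.continuous_exp.continuousOn
    isClosed_univ (Filter.Eventually.of_forall fun _ => Set.mem_univ _) hX hint)

/-- The moment generating function of `|g|`, for a standard Gaussian variable `g`. -/
noncomputable def absGaussianMgf (θ : ℝ) : ℝ :=
  (∫ t : ℝ, Real.exp (-(1 / 2) * t ^ 2) * Real.exp (θ * |t|)) / √(2 * Real.pi)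

theorem integrable_exp_mul_abs (θ : ℝ) :
    Integrable fun t : ℝ => Real.exp (-(1 / 2) * t ^ 2) * Real.exp (θ * |t|) := by
  refine Integrable.mono' ((integrable_exp_neg_mul_sq (b := 1 / 4) (by norm_num)).const_mul
    (Real.exp (θ ^ 2))) (by fun_prop) (Filter.Eventually.of_forall fun t => ?_)
  rw [Real.norm_of_nonneg (by positivity), ← Real.exp_add, ← Real.exp_add]
  refine Real.exp_le_exp.mpr ?_
  nlinarith [sq_nonneg (θ - |t| / 2), sq_abs t]

/-- A reflection carries `a` to a coordinate vector and preserves the Gaussian weight; the integral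
then factors over the coordinates. -/
theorem lintegral_exp_mul_abs_inner {a : EuclideanSpace ℝ ι} (ha : ‖a‖ = 1) (θ : ℝ) :
    ∫⁻ x, ENNReal.ofReal (Real.exp (-(1 / 2) * ‖x‖ ^ 2)) *
        ENNReal.ofReal (Real.exp (θ * |inner ℝ a x|)) =
      ENNReal.ofReal (√(2 * Real.pi) ^ Fintype.card ι * absGaussianMgf θ) := by
  classical
  obtain ⟨j⟩ := ‹Nonempty ι›
  let e : EuclideanSpace ℝ ι := EuclideanSpace.single j 1
  let T := (ℝ ∙ (a - e))ᗮ.reflection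
  have hT : T a = e := Submodule.reflection_sub (by simp [e, ha])
  have hTx : ∀ x, inner ℝ a x = (T x) j := fun x => by
    rw [← T.inner_map_map, hT, EuclideanSpace.inner_single_left]; simp
  let g : ι → ℝ → ℝ := fun i t =>
    Real.exp (-(1 / 2) * t ^ 2) * if i = j then Real.exp (θ * |t|) else 1
  have hg : ∀ x : EuclideanSpace ℝ ι, ∏ i, g i (x i) =
      Real.exp (-(1 / 2) * ‖x‖ ^ 2) * Real.exp (θ * |x j|) := fun x => by
    simp only [g]
    rw [Finset.prod_mul_distrib, ← exp_neg_mul_norm_sq]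
    simp
  have hgint : ∀ i, Integrable (g i) := fun i => by
    by_cases hi : i = j
    · simpa [g, hi] using integrable_exp_mul_abs θ
    · simpa [g, hi] using integrable_exp_neg_mul_sq (b := 1 / 2) (by norm_num)
  have hgval : ∀ i, ∫ t, g i t = √(2 * Real.pi) * if i = j then absGaussianMgf θ else 1 := by
    intro i
    by_cases hi : i = j
    · simp only [g, hi, if_true, absGaussianMgf]
      field_simp
    · simp only [g, hi, if_false, mul_one, integral_gaussian]
      congr 1
      field_simp
  have h1 : ∀ x : EuclideanSpace ℝ ι, ENNReal.ofReal (Real.exp (-(1 / 2) * ‖x‖ ^ 2)) *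
      ENNReal.ofReal (Real.exp (θ * |inner ℝ a x|)) = ENNReal.ofReal (∏ i, g i (T x i)) := by
    intro x
    rw [hg, ENNReal.ofReal_mul (Real.exp_pos _).le, LinearIsometryEquiv.norm_map, hTx]
  simp only [h1]
  have hint := integrable_prod_euclideanSpace hgint
  rw [T.measurePreserving.lintegral_comp_emb T.toMeasurableEquiv.measurableEmbedding
      (fun x => ENNReal.ofReal (∏ i, g i (x i))),
    ← ofReal_integral_eq_lintegral_ofReal hint (Filter.Eventually.of_forall fun x => by
      simp only [hg, Pi.zero_apply]; positivity), integral_prod_euclideanSpace]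
  simp only [hgval]
  rw [Finset.prod_mul_distrib]
  simp

/-- With a suitable normalization, the absolute value of a coordinate of a uniform point of the
sphere has a smaller moment generating function than that of a standard Gaussian variable. -/
theorem exists_scale_lintegral_exp_le (ι : Type*) [Fintype ι] [Nonempty ι] :
    ∃ κ : ℝ, 0 < κ ∧ ∀ a : EuclideanSpace ℝ ι, ‖a‖ = 1 → ∀ θ : ℝ,
      ∫⁻ u : Metric.sphere (0 : EuclideanSpace ℝ ι) 1,
        ENNReal.ofReal (Real.exp (θ * (κ * |inner ℝ a (u : EuclideanSpace ℝ ι)|)))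
          ∂(uniformOnSphere ι) ≤ ENNReal.ofReal (absGaussianMgf θ) := by
  set ρ := gaussianRadial ι
  let ν := (ρ Set.univ)⁻¹ • ρ
  have : NeZero ρ := ⟨fun h => gaussianRadial_univ_ne_zero (ι := ι) (by
    rw [show gaussianRadial ι = 0 from h]; simp)⟩
  have : IsProbabilityMeasure ν := ⟨by
    rw [Measure.smul_apply, smul_eq_mul,
      ENNReal.inv_mul_cancel gaussianRadial_univ_ne_zero (measure_ne_top _ _)]⟩
  have hint : Integrable (fun t : Set.Ioi (0 : ℝ) => t.1) ν :=
    (integrable_gaussianRadial (ι := ι)).smul_measure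
      (ENNReal.inv_ne_top.mpr gaussianRadial_univ_ne_zero)
  -- The scale is the mean radius of a standard Gaussian vector; Jensen's inequality is applied
  -- along each ray.
  refine ⟨∫ t : Set.Ioi (0 : ℝ), t.1 ∂ν, ?_, fun a ha θ => ?_⟩
  · rw [integral_pos_iff_support_of_nonneg (fun t => le_of_lt t.2) hint]
    have : Function.support (fun t : Set.Ioi (0 : ℝ) => t.1) = Set.univ := by
      ext t; simpa using ne_of_gt t.2
    rw [this, measure_univ]; exact one_pos
  · have h := lintegral_uniformOnSphere_mul_le (ι := ι)
      (f := fun x => ENNReal.ofReal (Real.exp (θ * |inner ℝ a x|)))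
      (φ := fun u => ENNReal.ofReal (Real.exp (θ * ((∫ t : Set.Ioi (0 : ℝ), t.1 ∂ν) *
        |inner ℝ a (u : EuclideanSpace ℝ ι)|)))) (by fun_prop) (by fun_prop) fun u => by
      have h1 := ofReal_exp_integral_le ν
        (hint.const_mul (θ * |inner ℝ a (u : EuclideanSpace ℝ ι)|))
      rw [integral_const_mul, lintegral_smul_measure, smul_eq_mul] at h1
      rw [mul_comm, ENNReal.mul_le_iff_le_inv gaussianRadial_univ_ne_zero (measure_ne_top _ _)]
      refine (le_of_eq ?_).trans (h1.trans (le_of_eq ?_))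
      · congr 2; ring
      · congr 1
        refine lintegral_congr fun t => ?_
        rw [inner_smul_right, abs_mul, abs_of_pos (show (0 : ℝ) < t.1 from t.2)]
        congr 2; ring
    rw [lintegral_exp_mul_abs_inner ha, mul_comm, ENNReal.ofReal_mul (by positivity)] at h
    exact (ENNReal.mul_le_mul_iff_right (ENNReal.ofReal_pos.mpr (by positivity)).ne'
      ENNReal.ofReal_ne_top).mp h

/-- A tail bound for the ratio of the norms of the two blocks of a uniform point of the sphere. -/
theorem uniformOnSphere_ratio_le {s r : ℕ} [Nonempty (Fin s ⊕ Fin r)] {q : ℝ} (hq : 0 ≤ q) :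
    uniformOnSphere (Fin s ⊕ Fin r) {u | q * ∑ j, u.1 (Sum.inr j) ^ 2 <
        ∑ i, u.1 (Sum.inl i) ^ 2} ≤ ENNReal.ofReal (√2 ^ s * (1 / √(1 + q / 2)) ^ r) := by
  set A : Set (Metric.sphere (0 : EuclideanSpace ℝ (Fin s ⊕ Fin r)) 1) :=
    {u | q * ∑ j, u.1 (Sum.inr j) ^ 2 < ∑ i, u.1 (Sum.inl i) ^ 2} with hA
  have hAm : MeasurableSet A := measurableSet_lt (by fun_prop) (by fun_prop)
  -- The exponent is homogeneous of degree 2, so ψ ≥ 1 on the whole ray through a bad direction. The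
  -- weight 1/4 keeps the Gaussian integral finite: each common coordinate contributes √2, each
  -- innovation coordinate 1/√(1+q/2).
  let ψ : EuclideanSpace ℝ (Fin s ⊕ Fin r) → ℝ := fun x =>
    Real.exp (1 / 4 * (∑ i, x (Sum.inl i) ^ 2 - q * ∑ j, x (Sum.inr j) ^ 2))
  have hψ : Measurable ψ := by fun_prop
  have h := lintegral_uniformOnSphere_mul_le (f := fun x => ENNReal.ofReal (ψ x))
    (φ := A.indicator 1) (by fun_prop) (measurable_one.indicator hAm) fun u => by
    by_cases hu : u ∈ A
    · rw [Set.indicator_of_mem hu, Pi.one_apply, one_mul, ← lintegral_one]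
      refine lintegral_mono fun t => ?_
      rw [ENNReal.one_le_ofReal]
      refine Real.one_le_exp ?_
      have h1 : q * ∑ j, u.1 (Sum.inr j) ^ 2 < ∑ i, u.1 (Sum.inl i) ^ 2 := hu
      simp only [PiLp.smul_apply, smul_eq_mul, mul_pow, ← Finset.mul_sum]
      have h2 : 0 ≤ t.1 ^ 2 * (∑ i, u.1 (Sum.inl i) ^ 2 - q * ∑ j, u.1 (Sum.inr j) ^ 2) :=
        mul_nonneg (sq_nonneg _) (by linarith)
      linarith
    · rw [Set.indicator_of_notMem hu, zero_mul]; exact zero_le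
  rw [lintegral_indicator_one hAm] at h
  let g : Fin s ⊕ Fin r → ℝ → ℝ := Sum.elim (fun _ t => Real.exp (-(1 / 4) * t ^ 2))
    (fun _ t => Real.exp (-(1 / 2 + q / 4) * t ^ 2))
  have hg : ∀ x : EuclideanSpace ℝ (Fin s ⊕ Fin r),
      Real.exp (-(1 / 2) * ‖x‖ ^ 2) * ψ x = ∏ i, g i (x i) := fun x => by
    simp only [g, ψ, Fintype.prod_sum_type, Sum.elim_inl, Sum.elim_inr, ← Real.exp_sum,
      ← Real.exp_add, ← Finset.mul_sum, EuclideanSpace.real_norm_sq_eq, Fintype.sum_sum_type]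
    congr 1; ring
  have hgint : ∀ i, Integrable (g i) := by
    rintro (i | i)
    · exact integrable_exp_neg_mul_sq (by norm_num)
    · exact integrable_exp_neg_mul_sq (by positivity)
  simp only [← ENNReal.ofReal_mul (Real.exp_pos _).le, hg] at h
  rw [← ofReal_integral_eq_lintegral_ofReal (integrable_prod_euclideanSpace hgint)
      (Filter.Eventually.of_forall fun x => by simp only [← hg, Pi.zero_apply, ψ]; positivity),
    integral_prod_euclideanSpace] at h
  simp only [g, Fintype.prod_sum_type, Sum.elim_inl, Sum.elim_inr, integral_gaussian,
    Finset.prod_const, Finset.card_univ, Fintype.card_fin, Fintype.card_sum] at h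
  have h4 : √(Real.pi / (1 / 4)) = √(2 * Real.pi) * √2 := by
    rw [← Real.sqrt_mul (by positivity)]; congr 1; ring
  have h5 : √(Real.pi / (1 / 2 + q / 4)) = √(2 * Real.pi) * (1 / √(1 + q / 2)) := by
    rw [mul_one_div, ← Real.sqrt_div (by positivity)]
    congr 1
    field_simp
    ring
  have h6 : √(Real.pi / (1 / 4)) ^ s * √(Real.pi / (1 / 2 + q / 4)) ^ r =
      √(2 * Real.pi) ^ (s + r) * (√2 ^ s * (1 / √(1 + q / 2)) ^ r) := by
    rw [h4, h5]; ring
  rw [h6, mul_comm, ENNReal.ofReal_mul (by positivity)] at h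
  exact (ENNReal.mul_le_mul_iff_right (ENNReal.ofReal_pos.mpr (by positivity)).ne'
    ENNReal.ofReal_ne_top).mp h

end Polar

/-! ### Nets of the sphere -/

section Nets

/-- Volume comparison: disjoint balls of radius 1/(2k) around the points fit into the ball of radius
1 + 1/(2k). -/
theorem card_le_of_separated_sphere {E : Type*} [NormedAddCommGroup E] [NormedSpace ℝ E]
    [FiniteDimensional ℝ E] {k : ℕ} (hk : 0 < k) (s : Finset E) (hs : ∀ c ∈ s, ‖c‖ = 1)
    (h : ∀ c ∈ s, ∀ d ∈ s, c ≠ d → 1 / (k : ℝ) ≤ ‖c - d‖) :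
    s.card ≤ (2 * k + 1) ^ Module.finrank ℝ E := by
  borelize E
  let μ : Measure E := Measure.addHaar
  have hk' : (0 : ℝ) < k := by exact_mod_cast hk
  have hδ : (0 : ℝ) < 1 / (2 * k) := by positivity
  have hρ : (0 : ℝ) < 1 + 1 / (2 * k) := by positivity
  have hdisj : (s : Set E).PairwiseDisjoint fun c => Metric.ball c (1 / (2 * k) : ℝ) := by
    intro c hc d hd hcd
    apply Metric.ball_disjoint_ball
    rw [dist_eq_norm]
    refine le_trans (le_of_eq ?_) (h c hc d hd hcd)
    field_simp
    norm_num
  have hsub : (⋃ c ∈ s, Metric.ball c (1 / (2 * k) : ℝ)) ⊆ Metric.ball 0 (1 + 1 / (2 * k)) := by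
    refine Set.iUnion₂_subset fun x hx => Metric.ball_subset_ball' ?_
    rw [dist_zero_right, hs x hx, add_comm]
  have hI : (s.card : ENNReal) * ENNReal.ofReal ((1 / (2 * k)) ^ Module.finrank ℝ E) ≤
      ENNReal.ofReal ((1 + 1 / (2 * k)) ^ Module.finrank ℝ E) := by
    have hm := measure_mono (μ := μ) hsub
    rw [measure_biUnion_finset hdisj fun c _ => Metric.isOpen_ball.measurableSet] at hm
    simp only [μ.addHaar_ball_of_pos _ hδ, μ.addHaar_ball_of_pos _ hρ, Finset.sum_const,
      nsmul_eq_mul, ← mul_assoc] at hm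
    exact (ENNReal.mul_le_mul_iff_left (Metric.measure_ball_pos _ _ zero_lt_one).ne'
      measure_ball_lt_top.ne).1 hm
  have hJ := ENNReal.toReal_le_of_le_ofReal (by positivity) hI
  rw [ENNReal.toReal_mul, ENNReal.toReal_natCast, ENNReal.toReal_ofReal (by positivity),
    ← le_div_iff₀ (by positivity), ← div_pow] at hJ
  rw [show (1 + 1 / (2 * (k : ℝ))) / (1 / (2 * k)) = 2 * k + 1 by field_simp] at hJ
  exact_mod_cast hJ

theorem exists_net_sphere (E : Type*) [NormedAddCommGroup E] [NormedSpace ℝ E]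
    [FiniteDimensional ℝ E] {k : ℕ} (hk : 0 < k) :
    ∃ N : Finset E, (∀ a ∈ N, ‖a‖ = 1) ∧ N.card ≤ (2 * k + 1) ^ Module.finrank ℝ E ∧
      ∀ u, ‖u‖ = 1 → ∃ a ∈ N, ‖u - a‖ ≤ 1 / (k : ℝ) := by
  classical
  let S : Set ℕ := {l | ∃ s : Finset E, (∀ c ∈ s, ‖c‖ = 1) ∧
    (∀ c ∈ s, ∀ d ∈ s, c ≠ d → 1 / (k : ℝ) ≤ ‖c - d‖) ∧ s.card = l}
  have hne : S.Nonempty := ⟨0, ∅, by simp⟩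
  have hbdd : BddAbove S := ⟨(2 * k + 1) ^ Module.finrank ℝ E, by
    rintro _ ⟨s, h1, h2, rfl⟩
    exact card_le_of_separated_sphere hk s h1 h2⟩
  obtain ⟨N, h1, h2, h3⟩ := Nat.sSup_mem hne hbdd
  refine ⟨N, h1, card_le_of_separated_sphere hk N h1 h2, fun u hu => ?_⟩
  by_contra! hcon
  have huN : u ∉ N := fun hmem => by
    have := hcon u hmem
    rw [sub_self, norm_zero] at this
    exact absurd this (not_lt.mpr (by positivity))
  have hmem : (insert u N).card ∈ S := by
    refine ⟨insert u N, ?_, ?_, rfl⟩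
    · intro c hc
      rcases Finset.mem_insert.mp hc with rfl | hc
      exacts [hu, h1 c hc]
    · intro c hc d hd hcd
      rcases Finset.mem_insert.mp hc with hc | hc <;> rcases Finset.mem_insert.mp hd with hd | hd
      · exact absurd (hc.trans hd.symm) hcd
      · exact hc ▸ (hcon d hd).le
      · rw [norm_sub_rev]; exact hd ▸ (hcon c hc).le
      · exact h2 c hc d hd hcd
  have := le_csSup hbdd hmem
  rw [Finset.card_insert_of_notMem huN] at this
  omega

/-- Bounds of `∑ |⟨a, b i⟩|` for the points `a` of a net give bounds for all `a`. -/
theorem sum_abs_inner_bounds_of_net {E : Type*} [NormedAddCommGroup E] [InnerProductSpace ℝ E]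
    [FiniteDimensional ℝ E] {κ : Type*} [Fintype κ] (b : κ → E) {N : Finset E}
    (hN : ∀ u, ‖u‖ = 1 → ∃ a ∈ N, ‖u - a‖ ≤ 1 / 50)
    {L B : ℝ} (hL : ∀ a ∈ N, L ≤ ∑ i, |inner ℝ a (b i)|)
    (hB : ∀ a ∈ N, ∑ i, |inner ℝ a (b i)| ≤ B) (a : E) :
    (L - B / 49) * ‖a‖ ≤ ∑ i, |inner ℝ a (b i)| ∧
      ∑ i, |inner ℝ a (b i)| ≤ 50 / 49 * B * ‖a‖ := by
  set F : E → ℝ := fun a => ∑ i, |inner ℝ a (b i)| with hF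
  have hsmul : ∀ (c : ℝ) a, F (c • a) = |c| * F a := fun c a => by
    simp only [hF, inner_smul_left, abs_mul, Finset.mul_sum, conj_trivial]
  have hsub : ∀ u v, F u ≤ F v + F (u - v) := fun u v => by
    simp only [hF, ← Finset.sum_add_distrib]
    refine Finset.sum_le_sum fun i _ => ?_
    have := abs_add_le (inner ℝ v (b i)) (inner ℝ (u - v) (b i))
    rwa [← inner_add_left, add_sub_cancel] at this
  by_cases ha : a = 0
  · subst ha; simp
  have hnorm : ‖a‖ ≠ 0 := norm_ne_zero_iff.mpr ha
  have hunit : ‖‖a‖⁻¹ • a‖ = 1 := by rw [norm_smul, norm_inv, norm_norm, inv_mul_cancel₀ hnorm]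
  have hFa : F a = ‖a‖ * F (‖a‖⁻¹ • a) := by
    rw [hsmul, abs_inv, abs_norm, mul_inv_cancel_left₀ hnorm]
  obtain ⟨u, hu, hmax⟩ := (isCompact_sphere (0 : E) 1).exists_isMaxOn
    ⟨‖a‖⁻¹ • a, by simpa using hunit⟩ (show ContinuousOn F _ by fun_prop)
  have hle : ∀ v, F v ≤ ‖v‖ * F u := fun v => by
    by_cases hv : v = 0
    · subst hv; simp [hF]
    · have hv' : ‖v‖ ≠ 0 := norm_ne_zero_iff.mpr hv
      have h1 : F (‖v‖⁻¹ • v) ≤ F u := hmax (by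
        rw [mem_sphere_zero_iff_norm, norm_smul, norm_inv, norm_norm, inv_mul_cancel₀ hv'])
      rw [hsmul, abs_inv, abs_norm] at h1
      rwa [← div_le_iff₀' (by positivity), div_eq_inv_mul]
  have hFu : 0 ≤ F u := Finset.sum_nonneg fun i _ => abs_nonneg _
  have hu1 : ‖u‖ = 1 := by simpa using hu
  -- The maximum over the sphere is at most B plus 1/50 of itself.
  have hsup : F u ≤ 50 / 49 * B := by
    obtain ⟨v, hv, hd⟩ := hN u hu1
    have := (hsub u v).trans (add_le_add (hB v hv) ((hle (u - v)).trans
      (mul_le_mul_of_nonneg_right hd hFu)))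
    linarith
  refine ⟨?_, ?_⟩
  · obtain ⟨v, hv, hd⟩ := hN _ hunit
    rw [norm_sub_rev] at hd
    have := ((hL v hv).trans (hsub v _)).trans (add_le_add_right ((hle _).trans
      (mul_le_mul_of_nonneg_right hd hFu)) _)
    show _ ≤ F a
    rw [hFa, mul_comm]
    refine mul_le_mul_of_nonneg_left ?_ (norm_nonneg a)
    linarith
  · show F a ≤ _
    rw [mul_comm]
    exact (hle a).trans (mul_le_mul_of_nonneg_left hsup (norm_nonneg a))

end Nets

/-! ### The moment generating function of the absolute value of a Gaussian variable -/

section AbsGaussian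

theorem integral_exp_mul_abs_eq (θ : ℝ) :
    ∫ t : ℝ, Real.exp (-(1 / 2) * t ^ 2) * Real.exp (θ * |t|) =
      2 * ∫ t in Set.Ioi (0 : ℝ), Real.exp (-(1 / 2) * t ^ 2) * Real.exp (θ * t) := by
  have h := integral_comp_abs (f := fun t : ℝ => Real.exp (-(1 / 2) * t ^ 2) * Real.exp (θ * t))
  simpa only [sq_abs] using h

theorem two_div_sqrt_two_pi : 2 / √(2 * Real.pi) = √(2 / Real.pi) := by
  rw [div_eq_iff (by positivity), ← Real.sqrt_mul (by positivity),
    show 2 / Real.pi * (2 * Real.pi) = 2 ^ 2 by field_simp, Real.sqrt_sq (by norm_num)]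

/-- Completing the square leaves the Gaussian integral over (-θ, ∞), which is at most half the total
mass plus θ; then 1 + z ≤ exp z. -/
theorem absGaussianMgf_le_of_nonneg {θ : ℝ} (hθ : 0 ≤ θ) :
    absGaussianMgf θ ≤ Real.exp (θ * √(2 / Real.pi) + θ ^ 2 / 2) := by
  let g : ℝ → ℝ := fun t => Real.exp (-(1 / 2) * t ^ 2)
  have hg : Integrable g := integrable_exp_neg_mul_sq (by norm_num)
  have h1 : ∫ t in Set.Ioi (0 : ℝ), Real.exp (-(1 / 2) * t ^ 2) * Real.exp (θ * t) =
      Real.exp (θ ^ 2 / 2) * ∫ t in Set.Ioi (-θ), g t := by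
    rw [← integral_const_mul, ← integral_indicator measurableSet_Ioi,
      ← integral_indicator measurableSet_Ioi,
      ← integral_sub_right_eq_self (Set.indicator (Set.Ioi (-θ)) _) θ]
    congr 1
    ext t
    by_cases ht : 0 < t
    · rw [Set.indicator_of_mem (by exact ht), Set.indicator_of_mem (by simpa using ht)]
      simp only [g, ← Real.exp_add]
      congr 1; ring
    · rw [Set.indicator_of_notMem (by exact ht), Set.indicator_of_notMem (by simpa using ht)]
  have h2 : ∫ t in Set.Ioi (-θ), g t ≤ √(2 * Real.pi) / 2 + θ := by
    rw [← Set.Ioc_union_Ioi_eq_Ioi (show -θ ≤ 0 by linarith),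
      setIntegral_union (Set.Ioc_disjoint_Ioi le_rfl) measurableSet_Ioi hg.integrableOn
        hg.integrableOn, add_comm]
    refine add_le_add (le_of_eq ?_) ?_
    · rw [integral_gaussian_Ioi]
      congr 2; field_simp
    · refine (setIntegral_mono_on hg.integrableOn (integrableOn_const (by simp))
        measurableSet_Ioc (fun t _ => Real.exp_le_one_iff.mpr (by nlinarith [sq_nonneg t]))).trans ?_
      simp [hθ]
  have hpos : 0 < √(2 * Real.pi) := by positivity
  rw [absGaussianMgf, integral_exp_mul_abs_eq, h1]
  calc _ ≤ 2 * (Real.exp (θ ^ 2 / 2) * (√(2 * Real.pi) / 2 + θ)) / √(2 * Real.pi) := by gcongr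
    _ = Real.exp (θ ^ 2 / 2) * (θ * √(2 / Real.pi) + 1) := by
      rw [← two_div_sqrt_two_pi]; field_simp; ring
    _ ≤ Real.exp (θ ^ 2 / 2) * Real.exp (θ * √(2 / Real.pi)) := by
      gcongr; exact Real.add_one_le_exp _
    _ = _ := by rw [← Real.exp_add, add_comm]

theorem exp_neg_le_quadratic {x : ℝ} (hx : 0 ≤ x) : Real.exp (-x) ≤ 1 - x + x ^ 2 / 2 := by
  have h1 := Real.quadratic_le_exp_of_nonneg hx
  rw [Real.exp_neg, inv_le_iff_one_le_mul₀ (Real.exp_pos x)]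
  have h2 : 0 ≤ 1 - x + x ^ 2 / 2 := by nlinarith [sq_nonneg (x - 1)]
  -- (1 + x + x²/2)(1 - x + x²/2) = 1 + x⁴/4.
  nlinarith [mul_le_mul_of_nonneg_left h1 h2, sq_nonneg (x ^ 2)]

theorem integral_Ioi_mul_exp : ∫ t in Set.Ioi (0 : ℝ), t * Real.exp (-(1 / 2) * t ^ 2) = 1 := by
  have h := integral_rpow_mul_exp_neg_mul_rpow (p := 2) (q := 1) (b := 1 / 2) (by norm_num)
    (by norm_num) (by norm_num)
  simp only [Real.rpow_one, Real.rpow_two] at h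
  rw [h]
  norm_num [Real.rpow_neg_one]

theorem integral_Ioi_sq_mul_exp :
    ∫ t in Set.Ioi (0 : ℝ), t ^ 2 * Real.exp (-(1 / 2) * t ^ 2) = √(2 * Real.pi) / 2 := by
  have h := integral_rpow_mul_exp_neg_mul_rpow (p := 2) (q := 2) (b := 1 / 2) (by norm_num)
    (by norm_num) (by norm_num)
  simp only [Real.rpow_two] at h
  rw [h, show ((2 : ℝ) + 1) / 2 = 1 / 2 + 1 by norm_num, Real.Gamma_add_one (by norm_num),
    Real.Gamma_one_half_eq, Real.sqrt_mul (by norm_num), one_div (2 : ℝ),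
    Real.inv_rpow (by norm_num), ← Real.rpow_neg (by norm_num),
    show -(-(2 + 1) / 2) = (1 : ℝ) + 1 / 2 by norm_num, Real.rpow_add (by norm_num), Real.rpow_one,
    ← Real.sqrt_eq_rpow]
  ring

theorem integrableOn_Ioi_mul_exp : IntegrableOn (fun t : ℝ => t * Real.exp (-(1 / 2) * t ^ 2))
    (Set.Ioi 0) := by
  have h := integrableOn_rpow_mul_exp_neg_mul_sq (b := 1 / 2) (by norm_num) (s := 1) (by norm_num)
  simpa only [Real.rpow_one] using h

theorem integrableOn_Ioi_sq_mul_exp :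
    IntegrableOn (fun t : ℝ => t ^ 2 * Real.exp (-(1 / 2) * t ^ 2)) (Set.Ioi 0) := by
  have h := integrableOn_rpow_mul_exp_neg_mul_sq (b := 1 / 2) (by norm_num) (s := 2) (by norm_num)
  simpa only [Real.rpow_two] using h

theorem integrableOn_Ioi_exp_mul (θ : ℝ) : IntegrableOn
    (fun t : ℝ => Real.exp (-(1 / 2) * t ^ 2) * Real.exp (θ * t)) (Set.Ioi 0) :=
  ((integrable_exp_mul_abs θ).integrableOn (s := Set.Ioi 0)).congr_fun
    (fun t ht => by simp only [abs_of_pos (show (0 : ℝ) < t from ht)]) measurableSet_Ioi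

/-- Integrate exp(-θt) ≤ 1 - θt + θ²t²/2, using E|g| = √(2/π) and E g² = 1. -/
theorem absGaussianMgf_neg_le {θ : ℝ} (hθ : 0 ≤ θ) :
    absGaussianMgf (-θ) ≤ Real.exp (-θ * √(2 / Real.pi) + θ ^ 2 / 2) := by
  have hpos : 0 < √(2 * Real.pi) := by positivity
  have hg : IntegrableOn (fun t : ℝ => Real.exp (-(1 / 2) * t ^ 2)) (Set.Ioi 0) :=
    (integrable_exp_neg_mul_sq (by norm_num)).integrableOn
  have h1 : ∫ t in Set.Ioi (0 : ℝ), Real.exp (-(1 / 2) * t ^ 2) * Real.exp (-θ * t) ≤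
      √(2 * Real.pi) / 2 - θ + θ ^ 2 / 2 * (√(2 * Real.pi) / 2) := by
    calc _ ≤ ∫ t in Set.Ioi (0 : ℝ), (Real.exp (-(1 / 2) * t ^ 2) -
          θ * (t * Real.exp (-(1 / 2) * t ^ 2)) +
          θ ^ 2 / 2 * (t ^ 2 * Real.exp (-(1 / 2) * t ^ 2))) := by
          refine setIntegral_mono_on (integrableOn_Ioi_exp_mul _)
            ((hg.sub (integrableOn_Ioi_mul_exp.const_mul _)).add
              (integrableOn_Ioi_sq_mul_exp.const_mul _)) measurableSet_Ioi fun t ht => ?_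
          have h2 := exp_neg_le_quadratic (mul_nonneg hθ (le_of_lt ht))
          rw [neg_mul θ t]
          have h3 := mul_le_mul_of_nonneg_left h2 (Real.exp_pos (-(1 / 2) * t ^ 2)).le
          nlinarith
      _ = _ := by
          have hsub := hg.sub (integrableOn_Ioi_mul_exp.const_mul θ)
          simp only [Pi.sub_def] at hsub
          rw [integral_add hsub
            (integrableOn_Ioi_sq_mul_exp.const_mul _),
            integral_sub hg (integrableOn_Ioi_mul_exp.const_mul _), integral_const_mul,
            integral_const_mul, integral_Ioi_mul_exp, integral_Ioi_sq_mul_exp,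
            integral_gaussian_Ioi, mul_one]
          congr 3
          field_simp
  rw [absGaussianMgf, integral_exp_mul_abs_eq]
  calc _ ≤ 2 * (√(2 * Real.pi) / 2 - θ + θ ^ 2 / 2 * (√(2 * Real.pi) / 2)) / √(2 * Real.pi) := by
        gcongr
    _ = -θ * √(2 / Real.pi) + θ ^ 2 / 2 + 1 := by
        rw [← two_div_sqrt_two_pi]; field_simp; ring
    _ ≤ _ := Real.add_one_le_exp _

/-- The density of |g| is at most √(2/π). For large θ this beats the sub-Gaussian bound and serves
small n/m. -/
theorem absGaussianMgf_neg_le_div {θ : ℝ} (hθ : 0 < θ) :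
    absGaussianMgf (-θ) ≤ √(2 / Real.pi) / θ := by
  have hpos : 0 < √(2 * Real.pi) := by positivity
  have h1 : ∫ t in Set.Ioi (0 : ℝ), Real.exp (-(1 / 2) * t ^ 2) * Real.exp (-θ * t) ≤ 1 / θ := by
    have h2 : ∫ t in Set.Ioi (0 : ℝ), Real.exp (-θ * t) = 1 / θ := by
      rw [integral_exp_mul_Ioi (by linarith) 0]; simp [neg_div_neg_eq]
    rw [← h2]
    refine setIntegral_mono_on (integrableOn_Ioi_exp_mul _)
      (integrableOn_exp_mul_Ioi (by linarith) 0) measurableSet_Ioi fun t _ => ?_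
    exact mul_le_of_le_one_left (Real.exp_pos _).le
      (Real.exp_le_one_iff.mpr (by nlinarith [sq_nonneg t]))
  rw [absGaussianMgf, integral_exp_mul_abs_eq, ← two_div_sqrt_two_pi]
  calc _ ≤ 2 * (1 / θ) / √(2 * Real.pi) := by gcongr
    _ = _ := by field_simp

theorem absGaussianMgf_nonneg (θ : ℝ) : 0 ≤ absGaussianMgf θ :=
  div_nonneg (integral_nonneg fun t => by positivity) (Real.sqrt_nonneg _)

end AbsGaussian

/-! ### Uniform bounds for the points of a cluster -/

section Chernoff

variable {Ω : Type*} [MeasurableSpace Ω] {P : Measure Ω} {ι : Type*} [Fintype ι] {n : ℕ}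
  {X : Fin n → Ω → Metric.sphere (0 : EuclideanSpace ℝ ι) 1}

theorem integrable_exp_sum_abs_inner [IsProbabilityMeasure P] (hX : ∀ i, AEMeasurable (X i) P)
    (a : EuclideanSpace ℝ ι) (θ : ℝ) :
    Integrable (fun ω => Real.exp (θ * ∑ i, |inner ℝ a (X i ω : EuclideanSpace ℝ ι)|)) P := by
  refine Integrable.of_bound (C := Real.exp (|θ| * ∑ _i : Fin n, ‖a‖)) ?_
    (Filter.Eventually.of_forall fun ω => ?_)
  · refine AEMeasurable.aestronglyMeasurable (Real.measurable_exp.comp_aemeasurable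
      (AEMeasurable.const_mul (Finset.aemeasurable_fun_sum _ fun i _ => ?_) θ))
    exact (show Measurable fun u : Metric.sphere (0 : EuclideanSpace ℝ ι) 1 =>
      |inner ℝ a (u : EuclideanSpace ℝ ι)| by fun_prop).comp_aemeasurable (hX i)
  · rw [Real.norm_of_nonneg (Real.exp_pos _).le, Real.exp_le_exp]
    refine (le_abs_self _).trans ?_
    rw [abs_mul]
    refine mul_le_mul_of_nonneg_left ?_ (abs_nonneg θ)
    rw [abs_of_nonneg (Finset.sum_nonneg fun i _ => abs_nonneg _)]
    refine Finset.sum_le_sum fun i _ => (abs_real_inner_le_norm _ _).trans ?_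
    rw [norm_eq_of_mem_sphere, mul_one]

theorem mgf_sum_abs_inner_le (hX : ∀ i, HasLaw (X i) (uniformOnSphere ι) P) (hind : iIndepFun X P)
    {a : EuclideanSpace ℝ ι} {θ B : ℝ} (hB : 0 ≤ B)
    (h : ∫⁻ u : Metric.sphere (0 : EuclideanSpace ℝ ι) 1,
      ENNReal.ofReal (Real.exp (θ * |inner ℝ a (u : EuclideanSpace ℝ ι)|)) ∂(uniformOnSphere ι) ≤
        ENNReal.ofReal B) :
    mgf (fun ω => ∑ i, |inner ℝ a (X i ω : EuclideanSpace ℝ ι)|) P θ ≤ B ^ n := by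
  have hm : Measurable fun u : Metric.sphere (0 : EuclideanSpace ℝ ι) 1 =>
      |inner ℝ a (u : EuclideanSpace ℝ ι)| := by fun_prop
  have h1 := (hind.comp (fun _ u => |inner ℝ a (u : EuclideanSpace ℝ ι)|) fun _ => hm).mgf_sum₀
    (t := θ) (fun i => hm.comp_aemeasurable (hX i).aemeasurable) Finset.univ
  have h2 : (fun ω => ∑ i, |inner ℝ a (X i ω : EuclideanSpace ℝ ι)|) =
      ∑ i, (fun u : Metric.sphere (0 : EuclideanSpace ℝ ι) 1 =>
        |inner ℝ a (u : EuclideanSpace ℝ ι)|) ∘ X i := by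
    ext ω; simp
  rw [h2, h1]
  refine (Finset.prod_le_prod (fun i _ => mgf_nonneg) fun i _ => ?_).trans
    (le_of_eq (by simp : ∏ _i : Fin n, B = B ^ n))
  rw [mgf, integral_eq_lintegral_of_nonneg_ae
    (Filter.Eventually.of_forall fun ω => (Real.exp_pos _).le)
    ((Real.measurable_exp.comp_aemeasurable
      ((hm.comp_aemeasurable (hX i).aemeasurable).const_mul θ)).aestronglyMeasurable)]
  refine ENNReal.toReal_le_of_le_ofReal hB (le_trans (le_of_eq ?_) h)
  exact (hX i).lintegral_comp (f := fun u => ENNReal.ofReal (Real.exp (θ *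
    |inner ℝ a (u : EuclideanSpace ℝ ι)|))) (by fun_prop)

/-- Probability that one of the uniform bounds `(λ₁ - λ₂/49) n/κ ≤ ∑ |⟨a, Xᵢ⟩| ≤ (50/49) λ₂ n/κ`
fails for some unit vector `a`. -/
theorem measureReal_not_bounds_le [IsProbabilityMeasure P] (hX : ∀ i, HasLaw (X i) (uniformOnSphere ι) P)
    (hind : iIndepFun X P) {κ : ℝ} (hκ : 0 < κ)
    (hmgf : ∀ a : EuclideanSpace ℝ ι, ‖a‖ = 1 → ∀ θ : ℝ,
      ∫⁻ u : Metric.sphere (0 : EuclideanSpace ℝ ι) 1,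
        ENNReal.ofReal (Real.exp (θ * (κ * |inner ℝ a (u : EuclideanSpace ℝ ι)|)))
          ∂(uniformOnSphere ι) ≤ ENNReal.ofReal (absGaussianMgf θ))
    {θ₁ θ₂ : ℝ} (hθ₁ : 0 ≤ θ₁) (hθ₂ : 0 ≤ θ₂) (l₁ l₂ : ℝ) :
    P.real {ω | ¬ ∀ a : EuclideanSpace ℝ ι,
        (l₁ - l₂ / 49) * (n / κ) * ‖a‖ ≤ ∑ i, |inner ℝ a (X i ω : EuclideanSpace ℝ ι)| ∧
        ∑ i, |inner ℝ a (X i ω : EuclideanSpace ℝ ι)| ≤ 50 / 49 * l₂ * (n / κ) * ‖a‖} ≤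
      101 ^ Fintype.card ι * ((Real.exp (θ₁ * l₁) * absGaussianMgf (-θ₁)) ^ n +
        (Real.exp (-θ₂ * l₂) * absGaussianMgf θ₂) ^ n) := by
  obtain ⟨N, hN1, hNcard, hN⟩ := exists_net_sphere (EuclideanSpace ℝ ι) (k := 50) (by norm_num)
  rw [finrank_euclideanSpace] at hNcard
  let F : EuclideanSpace ℝ ι → Ω → ℝ := fun a ω => ∑ i, |inner ℝ a (X i ω : EuclideanSpace ℝ ι)|
  have hle : ∀ a ∈ N, P.real ({ω | F a ω ≤ l₁ * (n / κ)} ∪ {ω | l₂ * (n / κ) ≤ F a ω}) ≤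
      (Real.exp (θ₁ * l₁) * absGaussianMgf (-θ₁)) ^ n +
        (Real.exp (-θ₂ * l₂) * absGaussianMgf θ₂) ^ n := by
    intro a ha
    have hm : ∀ θ : ℝ, mgf (F a) P (κ * θ) ≤ absGaussianMgf θ ^ n := fun θ =>
      mgf_sum_abs_inner_le hX hind (absGaussianMgf_nonneg θ) (by
        refine le_trans (le_of_eq ?_) (hmgf a (hN1 a ha) θ)
        refine lintegral_congr fun u => ?_
        congr 2; ring)
    have hint := fun θ => integrable_exp_sum_abs_inner (P := P)
      (fun i => (hX i).aemeasurable) a (κ * θ)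
    refine (measureReal_union_le _ _).trans (add_le_add ?_ ?_)
    -- Tilting by a multiple of κ makes the scale cancel against the threshold l₁ n/κ.
    · refine (measure_le_le_exp_mul_mgf (t := κ * -θ₁) _
        (mul_nonpos_of_nonneg_of_nonpos hκ.le (by linarith)) (hint _)).trans ?_
      rw [mul_pow, ← Real.exp_nat_mul]
      refine le_trans (le_of_eq ?_) (mul_le_mul_of_nonneg_left (hm (-θ₁)) (Real.exp_pos _).le)
      congr 2
      field_simp
    · refine (measure_ge_le_exp_mul_mgf (t := κ * θ₂) _ (by positivity) (hint _)).trans ?_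
      rw [mul_pow, ← Real.exp_nat_mul]
      refine le_trans (le_of_eq ?_) (mul_le_mul_of_nonneg_left (hm θ₂) (Real.exp_pos _).le)
      congr 2
      field_simp
  have hsub : {ω | ¬ ∀ a : EuclideanSpace ℝ ι,
        (l₁ - l₂ / 49) * (n / κ) * ‖a‖ ≤ F a ω ∧ F a ω ≤ 50 / 49 * l₂ * (n / κ) * ‖a‖} ⊆
      ⋃ a ∈ N, ({ω | F a ω ≤ l₁ * (n / κ)} ∪ {ω | l₂ * (n / κ) ≤ F a ω}) := by
    intro ω hω
    by_contra hcon
    simp only [Set.mem_iUnion, Set.mem_union, Set.mem_ofPred_eq, not_exists, not_or, not_le] at hcon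
    refine hω fun a => ?_
    have h := sum_abs_inner_bounds_of_net (fun i => (X i ω : EuclideanSpace ℝ ι))
      (fun u hu => by simpa using hN u hu)
      (fun a ha => (hcon a ha).1.le) (fun a ha => (hcon a ha).2.le) a
    refine ⟨le_trans (le_of_eq ?_) h.1, h.2.trans (le_of_eq ?_)⟩ <;> ring
  refine (measureReal_mono hsub (measure_ne_top _ _)).trans
    ((measureReal_biUnion_finset_le _ _).trans ((Finset.sum_le_card_nsmul _ _ _ hle).trans ?_))
  rw [nsmul_eq_mul]
  have h0 : (0 : ℝ) ≤ (Real.exp (θ₁ * l₁) * absGaussianMgf (-θ₁)) ^ n +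
      (Real.exp (-θ₂ * l₂) * absGaussianMgf θ₂) ^ n := by
    have := absGaussianMgf_nonneg θ₂
    have := absGaussianMgf_nonneg (-θ₁)
    positivity
  refine mul_le_mul_of_nonneg_right ?_ h0
  exact_mod_cast hNcard

end Chernoff

/-! ### Choice of the parameters -/

section Parameters

theorem sqrt_two_div_pi_bounds : 0.7978 < √(2 / Real.pi) ∧ √(2 / Real.pi) < 0.7979 := by
  have h1 := Real.pi_gt_d4
  have h2 := Real.pi_lt_d4
  constructor
  · rw [Real.lt_sqrt (by norm_num), lt_div_iff₀ Real.pi_pos]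
    nlinarith
  · rw [Real.sqrt_lt' (by norm_num), div_lt_iff₀ Real.pi_pos]
    nlinarith

/-- The net of mesh 1/50 has at most 101^m points, so 4.62 is its entropy per dimension. -/
theorem one_hundred_one_le_exp : (101 : ℝ) ≤ Real.exp 4.62 := by
  have h1 : (101 : ℝ) ^ 50 ≤ Real.exp 4.62 ^ 50 := by
    rw [← Real.exp_nat_mul, show ((50 : ℕ) : ℝ) * 4.62 = (231 : ℕ) * 1 by norm_num,
      Real.exp_nat_mul]
    refine le_trans ?_ (pow_le_pow_left₀ (by norm_num) Real.exp_one_gt_d9.le 231)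
    norm_num
  exact le_of_pow_le_pow_left₀ (by norm_num) (Real.exp_pos _).le h1

theorem exp_seven_quarters_lt : Real.exp (7 / 4) < 5.77 := by
  have h1 : Real.exp (7 / 4) ^ 4 < 5.77 ^ 4 := by
    rw [← Real.exp_nat_mul, show ((4 : ℕ) : ℝ) * (7 / 4) = (7 : ℕ) * 1 by norm_num,
      Real.exp_nat_mul]
    refine lt_of_lt_of_le (pow_lt_pow_left₀ Real.exp_one_lt_d9 (Real.exp_pos _).le (by norm_num)) ?_
    norm_num
  exact lt_of_pow_lt_pow_left₀ 4 (by norm_num) h1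

theorem exp_mul_absGaussianMgf_le {t : ℝ} (ht : 0 ≤ t) :
    Real.exp (-t * (√(2 / Real.pi) + t)) * absGaussianMgf t ≤ Real.exp (-(t ^ 2 / 2)) := by
  refine (mul_le_mul_of_nonneg_left (absGaussianMgf_le_of_nonneg ht) (Real.exp_pos _).le).trans ?_
  rw [← Real.exp_add, Real.exp_le_exp]
  linarith

theorem exp_mul_absGaussianMgf_neg_le {t : ℝ} (ht : 0 ≤ t) :
    Real.exp (t * (√(2 / Real.pi) - t)) * absGaussianMgf (-t) ≤ Real.exp (-(t ^ 2 / 2)) := by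
  refine (mul_le_mul_of_nonneg_left (absGaussianMgf_neg_le ht) (Real.exp_pos _).le).trans ?_
  rw [← Real.exp_add, Real.exp_le_exp]
  linarith

/-- Here √(2/π) - 3.15/x is too small, possibly negative, to be a useful lower threshold. But y is
small as well, so a fixed l₁ does; θ₁ = 1/l₁ minimises exp(θ l₁)/θ. -/
theorem exists_lower_parameters_of_le {x y : ℝ} (hx : 2 < √(2 / Real.pi) * x) (hx5 : x ≤ 5)
    (hy : y = (√(2 / Real.pi) * x - 2) / (x + 2)) :
    ∃ l₁ θ₁ τ₁ : ℝ, 0 ≤ θ₁ ∧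
      50 / 49 * (√(2 / Real.pi) + 3.15 / x) * y ^ 2 < l₁ - (√(2 / Real.pi) + 3.15 / x) / 49 ∧
      Real.exp (θ₁ * l₁) * absGaussianMgf (-θ₁) ≤ Real.exp (-τ₁) ∧
      4.62 + y ^ 2 / 2 ≤ τ₁ * x ^ 2 := by
  obtain ⟨hμ1, hμ2⟩ := sqrt_two_div_pi_bounds
  set μ := √(2 / Real.pi)
  have hx2 : 2.506 < x := by nlinarith
  have hy0 : 0 ≤ y := by rw [hy]; exact div_nonneg (by linarith) (by linarith)
  have hy1 : y ≤ 0.2843 := by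
    rw [hy, div_le_iff₀ (by linarith)]
    nlinarith
  have hy2 : y ^ 2 ≤ 0.0809 := by nlinarith
  refine ⟨0.216, 1 / 0.216, 3 / 4, by norm_num, ?_, ?_, by nlinarith⟩
  · have h1 : 3.15 / x ≤ 1.257 := by rw [div_le_iff₀ (by linarith)]; nlinarith
    have h2 : 0 ≤ 3.15 / x := by positivity
    have h3 : (μ + 3.15 / x) * y ^ 2 ≤ 2.0549 * 0.0809 := by
      refine mul_le_mul (by linarith) hy2 (sq_nonneg _) (by norm_num)
    linarith
  · refine (mul_le_mul_of_nonneg_left (absGaussianMgf_neg_le_div (by norm_num))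
      (Real.exp_pos _).le).trans ?_
    rw [Real.exp_neg, ← one_div, le_div_iff₀ (Real.exp_pos _), mul_right_comm, ← Real.exp_add,
      show (1 : ℝ) / 0.216 * 0.216 + 3 / 4 = 7 / 4 by norm_num]
    have h1 := mul_le_mul exp_seven_quarters_lt.le
      (show μ / (1 / 0.216) ≤ 0.17235 by
        rw [div_le_iff₀ (by norm_num)]; linarith)
      (by positivity) (by norm_num)
    refine h1.trans (by norm_num)

theorem exists_lower_parameters_of_ge {x y : ℝ} (hx5 : 5 ≤ x)
    (hy : y = (√(2 / Real.pi) * x - 2) / (x + 2)) :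
    ∃ l₁ θ₁ τ₁ : ℝ, 0 ≤ θ₁ ∧
      50 / 49 * (√(2 / Real.pi) + 3.15 / x) * y ^ 2 < l₁ - (√(2 / Real.pi) + 3.15 / x) / 49 ∧
      Real.exp (θ₁ * l₁) * absGaussianMgf (-θ₁) ≤ Real.exp (-τ₁) ∧
      4.62 + y ^ 2 / 2 ≤ τ₁ * x ^ 2 := by
  obtain ⟨hμ1, hμ2⟩ := sqrt_two_div_pi_bounds
  set μ := √(2 / Real.pi) with hμ
  have hx0 : 0 < x := by linarith
  have hy0 : 0 ≤ y := by
    rw [hy]; exact div_nonneg (by nlinarith) (by linarith)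
  have hy1 : y ≤ μ := by
    rw [hy, div_le_iff₀ (by linarith)]
    nlinarith
  refine ⟨μ - 3.15 / x, 3.15 / x, (3.15 / x) ^ 2 / 2, by positivity, ?_,
    exp_mul_absGaussianMgf_neg_le (by positivity), ?_⟩
  -- In w = 1/x ≤ 0.2 one has y = (μ - 2w)/(1 + 2w); clearing denominators leaves a cubic inequality
  -- in w.
  · obtain ⟨w, hw⟩ : ∃ w, w = 1 / x := ⟨_, rfl⟩
    have hw0 : 0 < w := by rw [hw]; positivity
    have hw1 : w ≤ 0.2 := by rw [hw, div_le_iff₀ hx0]; linarith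
    have hyw : y * (1 + 2 * w) = μ - 2 * w := by
      rw [hy, hw]; field_simp
    have hyle : y * (1 + 2 * w) ≤ 0.7979 - 2 * w := by linarith
    rw [show 3.15 / x = 3.15 * w by rw [hw]; ring]
    have hD : 0 < (1 + 2 * w) ^ 2 := by positivity
    have hsq : y ^ 2 * (1 + 2 * w) ^ 2 ≤ (0.7979 - 2 * w) ^ 2 := by
      rw [← mul_pow]; exact pow_le_pow_left₀ (by positivity) hyle 2
    have h1 : (0.7979 + 3.15 * w) * (50 * (0.7979 - 2 * w) ^ 2 + (1 + 2 * w) ^ 2) <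
        49 * (0.7978 - 3.15 * w) * (1 + 2 * w) ^ 2 := by
      nlinarith [mul_nonneg hw0.le (sub_nonneg.mpr hw1),
        mul_nonneg (mul_nonneg hw0.le hw0.le) (sub_nonneg.mpr hw1)]
    have h2 : (μ + 3.15 * w) * (50 * y ^ 2 + 1) * (1 + 2 * w) ^ 2 <
        49 * (μ - 3.15 * w) * (1 + 2 * w) ^ 2 := by
      calc _ = (μ + 3.15 * w) * (50 * (y ^ 2 * (1 + 2 * w) ^ 2) + (1 + 2 * w) ^ 2) := by ring
        _ ≤ (0.7979 + 3.15 * w) * (50 * (0.7979 - 2 * w) ^ 2 + (1 + 2 * w) ^ 2) := by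
          gcongr
        _ < _ := h1
        _ ≤ _ := by gcongr
    have h3 := lt_of_mul_lt_mul_right h2 hD.le
    linarith
  · have : (3.15 / x) ^ 2 / 2 * x ^ 2 = 3.15 ^ 2 / 2 := by field_simp
    rw [this]
    nlinarith

theorem pow_mul_pow_le {m n : ℕ} {T τ q x : ℝ} (hT : 0 ≤ T) (hTτ : T ≤ Real.exp (-τ))
    (hx : x ^ 2 * m = n) (h : 4.62 + q / 2 ≤ τ * x ^ 2) :
    101 ^ m * T ^ n ≤ Real.exp (-(q * m / 2)) := by
  calc _ ≤ Real.exp 4.62 ^ m * Real.exp (-τ) ^ n := by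
        gcongr; exact one_hundred_one_le_exp
    _ = Real.exp (-((τ * x ^ 2 - 4.62) * m)) := by
        rw [← Real.exp_nat_mul, ← Real.exp_nat_mul, ← Real.exp_add, ← hx]; congr 1; ring
    _ ≤ _ := by
        rw [Real.exp_le_exp]
        have := mul_le_mul_of_nonneg_right h (Nat.cast_nonneg (α := ℝ) m)
        linarith

/-- Uniform bounds for the points of a cluster, with a ratio adapted to `n / m`. -/
theorem exists_bounds {m n : ℕ} {ι : Type*} [Fintype ι] [Nonempty ι] (hm : Fintype.card ι = m)
    {x y q : ℝ} (hxn : x ^ 2 * m = n) (hx : 2 < √(2 / Real.pi) * x)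
    (hy : y = (√(2 / Real.pi) * x - 2) / (x + 2)) (hqy : q ≤ y ^ 2) (hn : 0 < n) :
    ∃ H₁ H₂ : ℝ, 0 < H₂ ∧ H₂ * y ^ 2 < H₁ ∧
      ∀ {Ω : Type*} [MeasurableSpace Ω] (P : Measure Ω) [IsProbabilityMeasure P]
        (X : Fin n → Ω → Metric.sphere (0 : EuclideanSpace ℝ ι) 1),
        (∀ i, HasLaw (X i) (uniformOnSphere ι) P) → iIndepFun X P →
        P.real {ω | ¬ ∀ a : EuclideanSpace ℝ ι,
          H₁ * ‖a‖ ≤ ∑ i, |inner ℝ a (X i ω : EuclideanSpace ℝ ι)| ∧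
          ∑ i, |inner ℝ a (X i ω : EuclideanSpace ℝ ι)| ≤ H₂ * ‖a‖} ≤
        2 * Real.exp (-(q * m / 2)) := by
  obtain ⟨κ, hκ, hmgf⟩ := exists_scale_lintegral_exp_le ι
  have hμ0 : 0 < √(2 / Real.pi) := by positivity
  have hx0 : 0 < x := by
    by_contra hneg
    nlinarith
  have hnκ : 0 < n / κ := by positivity
  have hl₂ : 0 < √(2 / Real.pi) + 3.15 / x := by positivity
  obtain ⟨l₁, θ₁, τ₁, hθ₁, hl, hlow, hτ₁⟩ : ∃ l₁ θ₁ τ₁ : ℝ, 0 ≤ θ₁ ∧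
      50 / 49 * (√(2 / Real.pi) + 3.15 / x) * y ^ 2 < l₁ - (√(2 / Real.pi) + 3.15 / x) / 49 ∧
      Real.exp (θ₁ * l₁) * absGaussianMgf (-θ₁) ≤ Real.exp (-τ₁) ∧
      4.62 + y ^ 2 / 2 ≤ τ₁ * x ^ 2 := by
    rcases le_total x 5 with h5 | h5
    · exact exists_lower_parameters_of_le hx h5 hy
    · exact exists_lower_parameters_of_ge h5 hy
  refine ⟨(l₁ - (√(2 / Real.pi) + 3.15 / x) / 49) * (n / κ),
    50 / 49 * (√(2 / Real.pi) + 3.15 / x) * (n / κ), by positivity, ?_, ?_⟩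
  · rw [mul_right_comm]
    exact mul_lt_mul_of_pos_right hl hnκ
  intro Ω _ P _ X hX hind
  refine (measureReal_not_bounds_le hX hind hκ hmgf hθ₁ (θ₂ := 3.15 / x) (by positivity) l₁
    (√(2 / Real.pi) + 3.15 / x)).trans ?_
  rw [mul_add, two_mul, hm]
  refine add_le_add (pow_mul_pow_le (mul_nonneg (Real.exp_pos _).le (absGaussianMgf_nonneg _)) hlow
    hxn (by linarith)) (pow_mul_pow_le (mul_nonneg (Real.exp_pos _).le (absGaussianMgf_nonneg _))
      (exp_mul_absGaussianMgf_le (by positivity)) hxn ?_)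
  -- The choice 3.15: 3.15²/2 ≈ 4.961 exceeds the entropy 4.62 plus y²/2 ≤ 1/π.
  have h1 : (3.15 / x) ^ 2 / 2 * x ^ 2 = 3.15 ^ 2 / 2 := by field_simp
  rw [h1]
  have hμ2 := sqrt_two_div_pi_bounds.2
  have hy0 : 0 ≤ y := by rw [hy]; exact div_nonneg (by linarith) (by linarith)
  have hy1 : y ≤ √(2 / Real.pi) := by
    rw [hy, div_le_iff₀ (by linarith)]
    nlinarith
  nlinarith

end Parameters

/-! ### The quantities of the theorem -/

section Quantities

/-- This is why the block ratio is allowed to reach 3q: each innovation coordinate then gains a full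
factor exp(-q/2) in the tail bound. The range covers q ≤ y² ≤ 2/π. -/
theorem exp_le_one_add_mul {q : ℝ} (hq0 : 0 ≤ q) (hq : q ≤ 0.64) :
    Real.exp q ≤ 1 + 3 * q / 2 := by
  have h := Real.exp_bound' hq0 (by linarith) (n := 3) (by norm_num)
  norm_num [Finset.sum_range_succ, Nat.factorial] at h
  nlinarith [mul_nonneg hq0 (sub_nonneg.mpr hq),
    mul_nonneg (mul_nonneg hq0 hq0) (sub_nonneg.mpr hq)]

theorem sqrt_two_pow_mul_le {s r : ℕ} {q ε : ℝ} (hq0 : 0 ≤ q) (hq : q ≤ 0.64)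
    (hε : 2 * ε ^ 2 ≤ q * r - s) :
    √2 ^ s * (1 / √(1 + 3 * q / 2)) ^ r ≤ Real.exp (-ε ^ 2) := by
  have h1 : √2 ≤ Real.exp (1 / 2) := by
    rw [Real.exp_half]
    exact Real.sqrt_le_sqrt (by linarith [Real.exp_one_gt_d9])
  have h2 : 1 / √(1 + 3 * q / 2) ≤ Real.exp (-(q / 2)) := by
    rw [Real.exp_neg, ← one_div]
    refine one_div_le_one_div_of_le (Real.exp_pos _) ?_
    rw [Real.exp_half]
    exact Real.sqrt_le_sqrt (exp_le_one_add_mul hq0 hq)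
  calc _ ≤ Real.exp (1 / 2) ^ s * Real.exp (-(q / 2)) ^ r := by gcongr
    _ = Real.exp (-((q * r - s) / 2)) := by
        rw [← Real.exp_nat_mul, ← Real.exp_nat_mul, ← Real.exp_add]; congr 1; ring
    _ ≤ _ := by rw [Real.exp_le_exp]; linarith

/-- With A = √s + ζs/√(m-s), ε is the nonnegative root of 2ε² + 2Aε = s(ζ-1). -/
theorem two_mul_epsRate_sq_le {m s : ℕ} {ζ : ℝ} (hζ : 1 ≤ ζ) :
    2 * epsRate m s ζ ^ 2 ≤ s * (ζ - 1) := by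
  set A := √s + ζ * s / √((m : ℝ) - s) with hA
  have hA0 : 0 ≤ A := by positivity
  have hB : 0 ≤ 2 * (s : ℝ) * (ζ - 1) := mul_nonneg (by positivity) (by linarith)
  have hD := Real.sq_sqrt (add_nonneg (sq_nonneg A) hB)
  have hAD : A ≤ √(A ^ 2 + 2 * s * (ζ - 1)) := Real.le_sqrt_of_sq_le (by linarith)
  rw [epsRate, ← hA]
  nlinarith

/-! ### Affinities and disjointness of subspaces -/

section AffInf

variable {M : ℕ} {W₁ W₂ : Submodule ℝ (EuclideanSpace ℝ (Fin M))}

theorem bddAbove_affInf : BddAbove {a : ℝ | ∃ x ∈ W₁, ∃ y ∈ W₂, ‖x‖ = 1 ∧ ‖y‖ = 1 ∧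
    a = inner ℝ x y} :=
  ⟨1, by
    rintro _ ⟨x, _, y, _, hx, hy, rfl⟩
    simpa [hx, hy] using real_inner_le_norm x y⟩

theorem affInf_nonneg : 0 ≤ affInf W₁ W₂ := by
  by_cases h : {a : ℝ | ∃ x ∈ W₁, ∃ y ∈ W₂, ‖x‖ = 1 ∧ ‖y‖ = 1 ∧ a = inner ℝ x y}.Nonempty
  · obtain ⟨_, x, hx, y, hy, hx1, hy1, rfl⟩ := h
    have h1 : inner ℝ x y ≤ affInf W₁ W₂ :=
      le_csSup bddAbove_affInf ⟨x, hx, y, hy, hx1, hy1, rfl⟩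
    have h2 : inner ℝ x (-y) ≤ affInf W₁ W₂ :=
      le_csSup bddAbove_affInf ⟨x, hx, -y, neg_mem hy, hx1, by rwa [norm_neg], rfl⟩
    rw [inner_neg_right] at h2
    linarith
  · rw [affInf, Set.not_nonempty_iff_eq_empty.mp h, Real.sSup_empty]

theorem disjoint_of_affInf_lt_one (h : affInf W₁ W₂ < 1) : Disjoint W₁ W₂ := by
  rw [Submodule.disjoint_def]
  intro x hx1 hx2
  by_contra hx
  have hn : ‖‖x‖⁻¹ • x‖ = 1 := by
    rw [norm_smul, norm_inv, norm_norm, inv_mul_cancel₀ (norm_ne_zero_iff.mpr hx)]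
  have h1 : (1 : ℝ) ≤ affInf W₁ W₂ := le_csSup bddAbove_affInf
    ⟨_, W₁.smul_mem _ hx1, _, W₂.smul_mem _ hx2, hn, hn, by
      rw [real_inner_self_eq_norm_sq, hn, one_pow]⟩
  linarith

end AffInf

/-- Dropping the logarithmic term here and in `le_hUpper` bounds h₁/h₂ by (μx-2)/(x+2), a function
of x = √(n/m) alone. -/
theorem hLower_le (n m : ℕ) :
    hLower n m ≤ √n * (√(2 / Real.pi) * (√n / √m) - 2) := by
  have h : (n : ℝ) / √m = √n * (√n / √m) := by
    rw [← mul_div_assoc, Real.mul_self_sqrt (Nat.cast_nonneg n)]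
  have h2 : 0 ≤ √(2 * n * Real.log n / ((m : ℝ) - 1)) := Real.sqrt_nonneg _
  rw [hLower, h]
  linarith

theorem le_hUpper (n m : ℕ) : √n * (√n / √m + 2) ≤ hUpper n m := by
  have h : (n : ℝ) / √m = √n * (√n / √m) := by
    rw [← mul_div_assoc, Real.mul_self_sqrt (Nat.cast_nonneg n)]
  have h2 : 0 ≤ √(2 * n * Real.log n / ((m : ℝ) - 1)) := Real.sqrt_nonneg _
  rw [hUpper, h]
  linarith

theorem hLower_le_hUpper (n m : ℕ) : hLower n m ≤ hUpper n m := by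
  refine (hLower_le n m).trans (le_trans ?_ (le_hUpper n m))
  refine mul_le_mul_of_nonneg_left ?_ (Real.sqrt_nonneg _)
  have h1 := sqrt_two_div_pi_bounds.2
  have h2 : 0 ≤ √(n : ℝ) / √m := by positivity
  nlinarith

end Quantities

/-! ### Union bound and assembly of the theorem -/

section Main

/-- A union bound over the data points and the clusters. -/
theorem one_sub_le_measureReal_of_bad_events {Ω : Type*} [MeasurableSpace Ω] {P : Measure Ω}
    [IsProbabilityMeasure P] {α β : Type*} [Fintype α] [Fintype β] {A : α → Set Ω} {B : β → Set Ω}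
    {G : Set Ω} {p q : ℝ} (hA : ∀ a, P.real (A a) ≤ p) (hB : ∀ b, P.real (B b) ≤ q)
    (hG : ∀ ω, (∀ a, ω ∉ A a) → (∀ b, ω ∉ B b) → ω ∈ G) :
    1 - Fintype.card α * p - Fintype.card β * q ≤ P.real G := by
  have h1 : (Set.univ : Set Ω) ⊆ G ∪ ((⋃ a, A a) ∪ ⋃ b, B b) := fun ω _ => by
    by_contra hcon
    simp only [Set.mem_union, Set.mem_iUnion, not_or, not_exists] at hcon
    exact hcon.1 (hG ω hcon.2.1 hcon.2.2)
  have h2 := measureReal_mono h1 (measure_ne_top P _)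
  rw [probReal_univ] at h2
  have h3 := measureReal_union_le (μ := P) G ((⋃ a, A a) ∪ ⋃ b, B b)
  have h4 := measureReal_union_le (μ := P) (⋃ a, A a) (⋃ b, B b)
  have h5 : P.real (⋃ a, A a) ≤ Fintype.card α * p :=
    (measureReal_iUnion_fintype_le _).trans ((Finset.sum_le_card_nsmul _ _ p fun a _ => hA a).trans
      (by simp))
  have h6 : P.real (⋃ b, B b) ≤ Fintype.card β * q :=
    (measureReal_iUnion_fintype_le _).trans ((Finset.sum_le_card_nsmul _ _ q fun b _ => hB b).trans
      (by simp))
  linarith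

theorem iPursuitSucceeds_of_isEmpty {M : ℕ} {ι κ : Type*} [Fintype ι] [IsEmpty ι]
    (d : ι → EuclideanSpace ℝ (Fin M)) (S : κ → Submodule ℝ (EuclideanSpace ℝ (Fin M)))
    (cluster : ι → κ) : IPursuitSucceeds d S cluster :=
  iPursuitSucceeds_of_forall_inner_eq_zero d S cluster isEmptyElim isEmptyElim isEmptyElim

theorem sqrt_one_add_three_mul_le {q : ℝ} (hq : 0 ≤ q) : √(1 + 3 * q) ≤ (1 + √q) ^ 2 := by
  rw [Real.sqrt_le_left (by positivity)]
  have h := Real.sq_sqrt hq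
  have h0 := Real.sqrt_nonneg q
  nlinarith [pow_nonneg h0 3, pow_nonneg h0 4]

/-- Consequences of the assumptions on `hLower` and `hUpper`, in terms of `x = √(n / m)`. -/
theorem ratio_bounds {n m K : ℕ} (hn : 0 < n) (hm : 0 < m) {Q t₁ x y : ℝ} (hQ0 : 0 < √Q)
    (ht₁0 : 0 ≤ t₁) (hx : x = √(n : ℝ) / √m) (hy : y = (√(2 / Real.pi) * x - 2) / (x + 2))
    (hlow : 0 < hLower n m) (hcond₁ : hUpper n m * (√Q + t₁) ≤ hLower n m)
    (hcond₂ : hUpper n m * (√Q + 1) ≤ hLower n m * √((K : ℝ) - 1)) :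
    t₁ < 1 ∧ 2 < √(2 / Real.pi) * x ∧ x ^ 2 * m = n ∧ 2 ≤ (n : ℝ) ∧ 0 < y ∧ y ^ 2 ≤ 0.64 ∧
      √Q ≤ y ∧ √Q + 1 ≤ y * √((K : ℝ) - 1) := by
  have hn' : (0 : ℝ) < n := by exact_mod_cast hn
  have hm' : (0 : ℝ) < m := by exact_mod_cast hm
  have hx0 : 0 < x := by rw [hx]; positivity
  have hμ := sqrt_two_div_pi_bounds.2
  have hup : 0 < hUpper n m := lt_of_lt_of_le (by positivity) (le_hUpper n m)
  have hlowx := hLower_le n m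
  have hupx := le_hUpper n m
  rw [← hx] at hlowx hupx
  have hnum : 0 < √(2 / Real.pi) * x - 2 :=
    pos_of_mul_pos_right (lt_of_lt_of_le hlow hlowx) (Real.sqrt_nonneg _)
  have hy0 : 0 < y := by rw [hy]; exact div_pos hnum (by linarith)
  have hLy : hLower n m ≤ hUpper n m * y := by
    refine hlowx.trans ((le_of_eq ?_).trans (mul_le_mul_of_nonneg_right hupx hy0.le))
    rw [mul_assoc, hy, mul_div_cancel₀ _ (by positivity)]
  have hyμ : y ≤ 0.7979 := by
    rw [hy, div_le_iff₀ (by linarith)]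
    nlinarith
  have hxn : x ^ 2 * m = n := by
    rw [hx, div_pow, Real.sq_sqrt hn'.le, Real.sq_sqrt hm'.le, div_mul_cancel₀ _ hm'.ne']
  refine ⟨?_, by linarith, hxn, ?_, hy0, by nlinarith, ?_, ?_⟩
  -- If t₁ ≥ 1, then h₂(√Q + 1) ≤ h₁ ≤ h₂, impossible as √Q > 0.
  · by_contra hcon
    have h1 := hLower_le_hUpper n m
    have h2 := mul_le_mul_of_nonneg_left (show √Q + 1 ≤ √Q + t₁ by linarith) hup.le
    linarith [mul_pos hup hQ0]
  · have h2 : 2 ≤ x := by nlinarith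
    have h3 : (1 : ℝ) ≤ m := by exact_mod_cast hm
    nlinarith
  · refine le_of_mul_le_mul_left ?_ hup
    linarith [mul_nonneg hup.le ht₁0]
  · refine le_of_mul_le_mul_left ?_ hup
    rw [← mul_assoc]
    exact hcond₂.trans (mul_le_mul_of_nonneg_right hLy (Real.sqrt_nonneg _))

theorem theorem2
    {Ω : Type*} [MeasurableSpace Ω] (P : Measure Ω) [IsProbabilityMeasure P]
    (M K n m s r : ℕ) (hm : m = s + r)
    -- the deterministic subspaces, with orthonormal bases `U_k = [U, Û_k]`
    (U : Fin s → EuclideanSpace ℝ (Fin M))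
    (Uhat : Fin K → Fin r → EuclideanSpace ℝ (Fin M))
    (hU : ∀ k, Orthonormal ℝ (subspaceBasis U Uhat k))
    (hInnov : InnovationAssumption (clusterSpan U Uhat))
    -- the coefficient vectors, independent and uniform on the unit sphere of `ℝ^m`
    (b : Fin K × Fin n → Ω → Metric.sphere (0 : EuclideanSpace ℝ (Fin s ⊕ Fin r)) 1)
    (hlaw : ∀ p, HasLaw (b p) (uniformOnSphere (Fin s ⊕ Fin r)) P)
    (hindep : iIndepFun b P)
    (t₁ t₂ t₃ : ℝ)
    (ht₁ : ∀ k, affInf (innovationSpan Uhat k)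
      (⨆ j ∈ {j : Fin K | j ≠ k}, innovationSpan Uhat j) ≤ t₁)
    (ht₂ : ∀ i j, i ≠ j → affInf (innovationSpan Uhat i) (innovationSpan Uhat j) ≤ t₂)
    (ht₃ : 0 < t₃) (ht₃' : t₃ < 1)
    (hcond₁ : hUpper n m * (√(t₃ ^ 2 / (1 - t₃ ^ 2)) + t₁) ≤
      hLower n m * √(1 - ((K : ℝ) - 2) * t₂))
    (hcond₂ : hUpper n m * (√(t₃ ^ 2 / (1 - t₃ ^ 2)) + 1) ≤
      hLower n m * √((K : ℝ) - 1))
    (hζ : 1 < zetaRatio K m s t₂ t₃) :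
    1 - 2 / (n : ℝ) -
        2 * ((K : ℝ) * n) * Real.exp (-(epsRate m s (zetaRatio K m s t₂ t₃)) ^ 2) ≤
      P.real {ω | IPursuitSucceeds
        (dataPoints U Uhat fun p => (b p ω : EuclideanSpace ℝ (Fin s ⊕ Fin r)))
        (clusterSpan U Uhat) Prod.fst} := by
  set ε := epsRate m s (zetaRatio K m s t₂ t₃) with hε
  -- Without data points the claim is trivial; 2/n is 0 if n = 0.
  by_cases hne : IsEmpty (Fin K × Fin n)
  · have huniv : {ω | IPursuitSucceeds
        (dataPoints U Uhat fun p => (b p ω : EuclideanSpace ℝ (Fin s ⊕ Fin r)))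
        (clusterSpan U Uhat) Prod.fst} = Set.univ :=
      Set.eq_univ_of_forall fun ω => iPursuitSucceeds_of_isEmpty _ _ _
    rw [huniv, probReal_univ]
    have h1 : 0 ≤ 2 / (n : ℝ) := by positivity
    have h2 : 0 ≤ 2 * ((K : ℝ) * n) * Real.exp (-ε ^ 2) := by positivity
    linarith
  obtain ⟨⟨k₀, i₀⟩⟩ := not_isEmpty_iff.mp hne
  have hn : 0 < n := i₀.pos
  have hn' : (0 : ℝ) < n := by exact_mod_cast hn
  have ht₃sq : 0 < 1 - t₃ ^ 2 := by nlinarith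
  set Q := t₃ ^ 2 / (1 - t₃ ^ 2) with hQ
  have hQ0 : 0 < √Q := Real.sqrt_pos.mpr (by positivity)
  have hms : (m : ℝ) - s = r := by rw [hm]; push_cast; ring
  -- the dimensions are positive
  have hs : 0 < s := by
    rcases Nat.eq_zero_or_pos s with rfl | h
    -- For s = 0 the quotient ζ has denominator 0, hence equals 0.
    · norm_num [zetaRatio] at hζ
    · exact h
  have hr : 0 < r := by
    rcases Nat.eq_zero_or_pos r with h | h
    · rw [zetaRatio, hms, h, Nat.cast_zero, zero_mul, zero_div] at hζ
      exact absurd hζ (by norm_num)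
    · exact h
  have hs' : (0 : ℝ) < s := by exact_mod_cast hs
  have hr' : (0 : ℝ) < r := by exact_mod_cast hr
  have hmpos : 0 < m := by omega
  have hm' : (0 : ℝ) < m := by exact_mod_cast hmpos
  -- consequences of the assumptions on `hLower` and `hUpper`
  set x := √(n : ℝ) / √m with hx
  have hup : 0 < hUpper n m := lt_of_lt_of_le (by positivity) (le_hUpper n m)
  have hR : 0 < hLower n m * √((K : ℝ) - 1) := lt_of_lt_of_le (by positivity) hcond₂
  have hlow : 0 < hLower n m := pos_of_mul_pos_left hR (Real.sqrt_nonneg _)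
  have hK : 0 < (K : ℝ) - 1 := Real.sqrt_pos.mp (pos_of_mul_pos_right hR hlow.le)
  have hK2 : 2 ≤ K := by
    have : (1 : ℝ) < K := by linarith
    exact_mod_cast this
  have hK2' : (2 : ℝ) ≤ K := by exact_mod_cast hK2
  have ht₁0 : 0 ≤ t₁ := affInf_nonneg.trans (ht₁ k₀)
  have ht₂0 : 0 ≤ t₂ := affInf_nonneg.trans
    (ht₂ ⟨0, by omega⟩ ⟨1, by omega⟩ (by simp [Fin.ext_iff]))
  -- This also covers a negative radicand, whose square root is 0.
  have hsq1 : √(1 - ((K : ℝ) - 2) * t₂) ≤ 1 := Real.sqrt_le_one.mpr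
    (by have := mul_nonneg (sub_nonneg.mpr hK2') ht₂0; linarith)
  have hcond₁' : hUpper n m * (√Q + t₁) ≤ hLower n m :=
    hcond₁.trans (mul_le_of_le_one_right hlow.le hsq1)
  set y := (√(2 / Real.pi) * x - 2) / (x + 2) with hy
  obtain ⟨ht₁1, hx2, hxn, hn2, hy0, hy64, hQy, hQR⟩ :=
    ratio_bounds hn hmpos hQ0 ht₁0 hx hy hlow hcond₁' hcond₂
  -- the ratio `q`
  set q := (t₃ ^ 2 - ((K : ℝ) - 1) * t₂ ^ 2) / (1 - t₃ ^ 2) with hq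
  have hζq : s * zetaRatio K m s t₂ t₃ = q * r := by
    rw [zetaRatio, hms, hq]; field_simp
  have hq0 : 0 < q := by
    have h1 : 0 < q * r := by rw [← hζq]; exact mul_pos hs' (by linarith)
    exact pos_of_mul_pos_left h1 hr'.le
  have hqQ : √q ≤ √Q := by
    refine Real.sqrt_le_sqrt (div_le_div_of_nonneg_right ?_ ht₃sq.le)
    have := mul_nonneg hK.le (sq_nonneg t₂)
    linarith
  have hqy : q ≤ y ^ 2 := (Real.sqrt_le_left hy0.le).mp (hqQ.trans hQy)
  have hq64 : q ≤ 0.64 := hqy.trans hy64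
  have hεq : 2 * ε ^ 2 ≤ q * r - s := by
    have h1 := two_mul_epsRate_sq_le (m := m) (s := s) hζ.le
    rw [mul_sub, hζq, mul_one] at h1
    exact h1
  -- the uniform bounds
  have : Nonempty (Fin s ⊕ Fin r) := ⟨Sum.inl ⟨0, hs⟩⟩
  obtain ⟨H₁, H₂, hH₂, hH, hbounds⟩ := exists_bounds (ι := Fin s ⊕ Fin r) (m := m)
    (by simp [hm]) hxn hx2 hy hqy hn
  have hH₁ : 0 < H₁ := lt_of_le_of_lt (by positivity) hH
  have hHK : H₂ * √(1 + 3 * q) < ((K : ℝ) - 1) * H₁ := by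
    have h1 : √(1 + 3 * q) ≤ y ^ 2 * ((K : ℝ) - 1) := by
      refine (sqrt_one_add_three_mul_le hq0.le).trans ?_
      calc (1 + √q) ^ 2 ≤ (y * √((K : ℝ) - 1)) ^ 2 :=
            pow_le_pow_left₀ (by positivity) (by linarith) 2
        _ = _ := by rw [mul_pow, Real.sq_sqrt hK.le]
    have h2 := mul_le_mul_of_nonneg_left h1 hH₂.le
    have h3 := mul_lt_mul_of_pos_right hH hK
    linarith
  have hbad₁ : ∀ p, P.real {ω | 3 * q * ∑ j, (b p ω).1 (Sum.inr j) ^ 2 <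
      ∑ i, (b p ω).1 (Sum.inl i) ^ 2} ≤ Real.exp (-ε ^ 2) := fun p => by
    have h1 := uniformOnSphere_ratio_le (s := s) (r := r) (q := 3 * q) (by positivity)
    rw [← (hlaw p).map_eq, Measure.map_apply_of_aemeasurable (hlaw p).aemeasurable
      (measurableSet_lt (by fun_prop) (by fun_prop))] at h1
    exact (ENNReal.toReal_le_of_le_ofReal (by positivity) h1).trans
      (sqrt_two_pow_mul_le hq0.le hq64 hεq)
  have hbad₂ : ∀ k, P.real {ω | ¬ ∀ a : EuclideanSpace ℝ (Fin s ⊕ Fin r),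
      H₁ * ‖a‖ ≤ ∑ i, |inner ℝ a (b (k, i) ω : EuclideanSpace ℝ (Fin s ⊕ Fin r))| ∧
      ∑ i, |inner ℝ a (b (k, i) ω : EuclideanSpace ℝ (Fin s ⊕ Fin r))| ≤ H₂ * ‖a‖} ≤
      2 * Real.exp (-ε ^ 2) := fun k => by
    refine (hbounds P (fun i => b (k, i)) (fun i => hlaw _)
      (hindep.precomp (Prod.mk_right_injective k))).trans ?_
    refine mul_le_mul_of_nonneg_left (Real.exp_le_exp.mpr ?_) (by norm_num)
    -- q m ≥ q r ≥ 2ε² + s, so the cluster bounds fail no more often than 2 exp(-ε²).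
    have hrm := mul_le_mul_of_nonneg_left (show (r : ℝ) ≤ m by linarith) hq0.le
    linarith
  refine le_trans ?_ (one_sub_le_measureReal_of_bad_events hbad₁ hbad₂ fun ω h₁ h₂ => ?_)
  -- The Kn points and K clusters cost (Kn + 2K) exp(-ε²) ≤ 2Kn exp(-ε²), as n ≥ 2; the term 2/n is
  -- slack.
  · simp only [Fintype.card_prod, Fintype.card_fin, Nat.cast_mul]
    have h1 : 0 ≤ 2 / (n : ℝ) := by positivity
    have h2 : 0 ≤ (K : ℝ) * (n - 2) * Real.exp (-ε ^ 2) :=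
      mul_nonneg (mul_nonneg (by linarith) (by linarith)) (Real.exp_pos _).le
    linarith
  · simp only [Set.mem_ofPred_eq, not_lt, not_not] at h₁ h₂
    refine iPursuitSucceeds_of_bounds hU
      (fun k => disjoint_of_affInf_lt_one ((ht₁ k).trans_lt ht₁1)) _
      (fun p => norm_eq_of_mem_sphere _) hH₁ hH₂.le (q := 3 * q) (by positivity)
      (fun k a => (h₂ k a).1) (fun k a => (h₂ k a).2) h₁ hHK

end Main
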